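/- Let $d\ge 1$. Logarithms are natural and $d_{\mathsf{KL}}(\pi\|\rho)=\sum_i \pi_i\log(\pi_i/\rho_i)\in[0,\infty]$. A distribution on an alphabet $[d_0]$ is extended by $0$ to letters outside $[d_0]$, so that distributions on alphabets $[d]$ and $[d_0]$ of different sizes can be compared and mixed (the case $d_0=d$ is included). For a sample $x^n=(x_1,\dots,x_n)\in[d]^n$ let $N_i=\#\{j: x_j=i\}$, and let $\hat\pi_{\mathsf{opt}}(x^n)$ be the Braess–Sauer variable add-constant estimate on $[d]$, $$\hat\pi_{\mathsf{opt}}(i)=\frac{N_i+\beta_{N_i}}{\sum_{k\in[d]}(N_k+\beta_{N_k})},\qquad \beta_0=\tfrac12,\quad \beta_1=1,\quad \beta_r=\tfrac34\ \ (r\ge 2).$$ For a distribution $\pi^{(0)}$ on $[d_0]$ and $\Delta\ge 0$ let $B_{\mathrm{KL}}(\pi^{(0)},\Delta)$ be the set of distributions $\pi$ on $[d]$ with $d_{\mathsf{KL}}(\pi\|\pi^{(0)})\le\Delta$. Theorem. There is a sequence $\varepsilon_n=o(1/n)$ as $n\to\infty$, depending only on $d$, such that for every $n\ge 1$ and every real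 $\Delta\ge 0$ there is an $\alpha\in[0,1]$, depending only on $d,n,\Delta$, for which the estimator $\hat\pi=\alpha\,\hat\pi_{\mathsf{opt}}(X^n)+(1-\alpha)\,\pi^{(0)}$ satisfies, for every $d_0$ and every distribution $\pi^{(0)}$ on $[d_0]$, $$\sup_{\pi\in B_{\mathrm{KL}}(\pi^{(0)},\Delta)}\mathbb E\big[d_{\mathsf{KL}}(\pi\,\|\,\hat\pi)\big]\le\min\Big(\frac{d-1}{2n}+\varepsilon_n,\ \Delta\Big),$$ where the expectation is over $X^n=(X_1,\dots,X_n)$ i.i.d. with law $\pi$; in particular the left side is finite (the supremum over an empty set is $0$). -/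

import Mathlib

open MeasureTheory Filter
open scoped ENNReal

noncomputable section

/-- The distribution on the natural numbers whose letter `i < d` has mass `p i`.
Letters of every alphabet `[d] = {0, …, d - 1}` are natural numbers, so distributions on alphabets
of different sizes can be compared and mixed (each is zero outside its own alphabet). -/
def discreteLaw {d : ℕ} (p : Fin d → ℝ) : Measure ℕ :=
  ∑ i : Fin d, ENNReal.ofReal (p i) • Measure.dirac (i : ℕ)

/-- `letterCount x i` is the number `N_i` of occurrences of the letter `i` in the sample `x`. -/
def letterCount {n : ℕ} (x : Fin n → ℕ) (i : ℕ) : ℕ :=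
  (Finset.univ.filter fun j => x j = i).card

/-- The Braess–Sauer constants: `β₀ = 1/2`, `β₁ = 1`, `β_r = 3/4` for `r ≥ 2`. -/
def braessSauerConst : ℕ → ℝ
  | 0 => 1 / 2
  | 1 => 1
  | _ + 2 => 3 / 4

/-- The variable add-constant estimate on the alphabet `[d]`: the letter `i` with count `N_i = r`
gets a probability proportional to `r + β_r`. -/
def variableAddConst (d : ℕ) {n : ℕ} (x : Fin n → ℕ) (i : Fin d) : ℝ :=
  (letterCount x i + braessSauerConst (letterCount x i)) /
    ∑ k : Fin d, (letterCount x k + braessSauerConst (letterCount x k))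

/-- The interpolation estimator `α π_opt(x) + (1 - α) π⁽⁰⁾`. -/
def interpolationEstimator (d : ℕ) {d₀ : ℕ} (p₀ : Fin d₀ → ℝ) (α : ℝ) {n : ℕ} (x : Fin n → ℕ) :
    Measure ℕ :=
  ENNReal.ofReal α • discreteLaw (variableAddConst d x) +
    ENNReal.ofReal (1 - α) • discreteLaw p₀

/-- The distributions on `[d]` whose KL divergence (natural logarithm) to `p₀` is at most `Δ`. -/
def klBall (d : ℕ) {d₀ : ℕ} (p₀ : Fin d₀ → ℝ) (Δ : ℝ) : Set (Fin d → ℝ) :=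
  {p | p ∈ stdSimplex ℝ (Fin d) ∧
    InformationTheory.klDiv (discreteLaw p) (discreteLaw p₀) ≤ ENNReal.ofReal Δ}

/-- The expected KL loss `E[d_KL(p ‖ est(X₁, …, Xₙ))]` for `X₁, …, Xₙ` i.i.d. with law `p`. -/
def klRisk {d n : ℕ} (p : Fin d → ℝ) (est : (Fin n → ℕ) → Measure ℕ) : ℝ≥0∞ :=
  ∫⁻ x, InformationTheory.klDiv (discreteLaw p) (est x)
    ∂(Measure.pi fun _ : Fin n => discreteLaw p)

/-- The worst-case expected KL risk of the interpolation estimator over the KL ball. -/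
def worstCaseRisk (d n : ℕ) {d₀ : ℕ} (p₀ : Fin d₀ → ℝ) (Δ α : ℝ) : ℝ≥0∞ :=
  ⨆ p ∈ klBall d p₀ Δ, klRisk (n := n) p (interpolationEstimator d p₀ α)

end

/-! Only the two extreme values of `α` are needed. With `α = 0` the estimator is `π⁽⁰⁾` and its loss
is at most `Δ` by definition of the ball; with `α = 1` it is the Braess–Sauer estimate, which never
sees `π⁽⁰⁾`. Everything therefore rests on the bound `(d - 1) / (2n) + o(1/n)` for the Braess–Sauer
estimate, uniformly over the simplex.

The normalising sum is `n + ∑ β`, and `log (n + ∑ β) ≤ log n + ∑ β / n` splits the loss into a sum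
over letters, each term involving only that letter's count (`sum_mul_log_div_variableAddConst_le`).
Counts are binomial (`integral_letterCount`), so the risk is at most `(1/n) ∑ letterLoss n (p i)`.
It suffices that `letterLoss n p ≤ (1 - p) / 2 + o(1)` uniformly in `p`, because `∑ (1 - p i) = d -
1`.

Write `x = n p`. For large `x`, a fourth order Taylor bound for the logarithm and the binomial
central moments give an error `O(log x / x)` (`letterLoss_le_of_large`). For bounded `x`, the
binomial law tends to the Poisson law and `letterLoss n (x / n)` tends to `1 / 2 - poissonGap x`,
uniformly on compact sets (`eventually_forall_letterLoss_lt`).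

What remains is `poissonGap_nonneg`, where the particular constants `β` matter. Differentiating a
Poisson expectation takes a difference of the sequence, so `x` times the second derivative of the
gap is the Poisson expectation of `braessSauerCurv`, which is nonnegative from index 4 on. Hence it
is at least `exp (-x)` times an explicit cubic. Convexity, numerical values at 2 and 4, and the
behaviour at infinity then cover the half-line. -/

/-! ### Binomial expectations -/

/-- The expectation of `F N` for a binomial variable `N` with parameters `n` and `p`. -/
noncomputable def binomialExp (n : ℕ) (p : ℝ) (F : ℕ → ℝ) : ℝ :=
  ∑ k ∈ Finset.range (n + 1), (n.choose k : ℝ) * p ^ k * (1 - p) ^ (n - k) * F k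

lemma binomialExp_zero (p : ℝ) (F : ℕ → ℝ) : binomialExp 0 p F = F 0 := by
  simp [binomialExp]

lemma binomialExp_succ (n : ℕ) (p : ℝ) (F : ℕ → ℝ) :
    binomialExp (n + 1) p F
      = p * binomialExp n p (fun k => F (k + 1)) + (1 - p) * binomialExp n p F := by
  have h1 : (1 - p) * binomialExp n p F
      = (∑ k ∈ Finset.range (n + 1),
          (n.choose (k + 1) : ℝ) * p ^ (k + 1) * (1 - p) ^ (n - k) * F (k + 1))
        + (1 - p) ^ (n + 1) * F 0 := by
    rw [binomialExp, Finset.sum_range_succ', Finset.sum_range_succ, mul_add, Finset.mul_sum]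
    simp only [Nat.choose_succ_self, Nat.cast_zero, zero_mul, add_zero]
    congr 1
    · refine Finset.sum_congr rfl fun k hk => ?_
      have : n - k = (n - (k + 1)) + 1 := by have := Finset.mem_range.1 hk; omega
      rw [this, pow_succ]; ring
    · simp; ring
  rw [h1, binomialExp, Finset.sum_range_succ', binomialExp, Finset.mul_sum, ← add_assoc,
    ← Finset.sum_add_distrib]
  congr 1
  · refine Finset.sum_congr rfl fun k _ => ?_
    rw [Nat.choose_succ_succ, Nat.add_sub_add_right]
    push_cast; ring
  · simp

lemma binomialExp_add (n : ℕ) (p : ℝ) (F H : ℕ → ℝ) :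
    binomialExp n p (fun k => F k + H k) = binomialExp n p F + binomialExp n p H := by
  simp only [binomialExp, ← Finset.sum_add_distrib, mul_add]

lemma binomialExp_const_mul (n : ℕ) (p c : ℝ) (F : ℕ → ℝ) :
    binomialExp n p (fun k => c * F k) = c * binomialExp n p F := by
  simp only [binomialExp, Finset.mul_sum]
  exact Finset.sum_congr rfl fun k _ => by ring

lemma binomialExp_one (n : ℕ) (p : ℝ) : binomialExp n p (fun _ => 1) = 1 := by
  induction n with
  | zero => simp [binomialExp_zero]
  | succ n ih => rw [binomialExp_succ, ih]; ring

lemma binomialExp_const (n : ℕ) (p c : ℝ) : binomialExp n p (fun _ => c) = c := by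
  simpa [binomialExp_one] using binomialExp_const_mul n p c fun _ => 1

lemma binomialExp_mono (n : ℕ) {p : ℝ} (h0 : 0 ≤ p) (h1 : p ≤ 1) {F H : ℕ → ℝ}
    (h : ∀ k, F k ≤ H k) : binomialExp n p F ≤ binomialExp n p H := by
  refine Finset.sum_le_sum fun k _ => mul_le_mul_of_nonneg_left (h k) ?_
  have : 0 ≤ 1 - p := by linarith
  positivity

/-- The central moments of the binomial distribution up to order four. -/
lemma binomialExp_central_moments (n : ℕ) (p : ℝ) :
    binomialExp n p (fun k => (k : ℝ) - n * p) = 0 ∧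
    binomialExp n p (fun k => ((k : ℝ) - n * p) ^ 2) = n * p * (1 - p) ∧
    binomialExp n p (fun k => ((k : ℝ) - n * p) ^ 3) = n * p * (1 - p) * (1 - 2 * p) ∧
    binomialExp n p (fun k => ((k : ℝ) - n * p) ^ 4)
      = n * p * (1 - p) * (1 + 3 * (n - 2) * p * (1 - p)) := by
  induction n with
  | zero => simp [binomialExp_zero]
  | succ n ih =>
    obtain ⟨i1, i2, i3, i4⟩ := ih
    -- One more trial replaces the centred count `k - n p` by itself plus `1 - p` or minus `p`. Each
    -- moment of order at most four is then the expectation of a quartic in the old centred count.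
    have key : ∀ c a1 a2 a3 a4 : ℝ, binomialExp n p (fun k => c + a1 * ((k : ℝ) - n * p)
        + a2 * ((k : ℝ) - n * p) ^ 2 + a3 * ((k : ℝ) - n * p) ^ 3 + a4 * ((k : ℝ) - n * p) ^ 4)
        = c + a2 * (n * p * (1 - p)) + a3 * (n * p * (1 - p) * (1 - 2 * p))
          + a4 * (n * p * (1 - p) * (1 + 3 * (n - 2) * p * (1 - p))) := by
      intro c a1 a2 a3 a4
      simp only [binomialExp_add, binomialExp_const_mul, i1, i2, i3, i4, binomialExp_const]
      ring
    have key' : ∀ (F : ℕ → ℝ) (c a1 a2 a3 a4 : ℝ), (∀ k : ℕ, F k = c + a1 * ((k : ℝ) - n * p)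
        + a2 * ((k : ℝ) - n * p) ^ 2 + a3 * ((k : ℝ) - n * p) ^ 3 + a4 * ((k : ℝ) - n * p) ^ 4) →
        binomialExp n p F = c + a2 * (n * p * (1 - p)) + a3 * (n * p * (1 - p) * (1 - 2 * p))
          + a4 * (n * p * (1 - p) * (1 + 3 * (n - 2) * p * (1 - p))) := by
      intro F c a1 a2 a3 a4 h
      rw [← key c a1 a2 a3 a4]
      exact congrArg _ (funext h)
    refine ⟨?_, ?_, ?_, ?_⟩ <;> rw [binomialExp_succ]
    · rw [key' _ (1 - p) 1 0 0 0 fun k => by push_cast; ring,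
        key' _ (-p) 1 0 0 0 fun k => by push_cast; ring]
      ring
    · rw [key' _ ((1 - p) ^ 2) (2 * (1 - p)) 1 0 0 fun k => by push_cast; ring,
        key' _ (p ^ 2) (-2 * p) 1 0 0 fun k => by push_cast; ring]
      push_cast; ring
    · rw [key' _ ((1 - p) ^ 3) (3 * (1 - p) ^ 2) (3 * (1 - p)) 1 0 fun k => by push_cast; ring,
        key' _ (-p ^ 3) (3 * p ^ 2) (-3 * p) 1 0 fun k => by push_cast; ring]
      push_cast; ring
    · rw [key' _ ((1 - p) ^ 4) (4 * (1 - p) ^ 3) (6 * (1 - p) ^ 2) (4 * (1 - p)) 1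
          fun k => by push_cast; ring,
        key' _ (p ^ 4) (-4 * p ^ 3) (6 * p ^ 2) (-4 * p) 1 fun k => by push_cast; ring]
      push_cast; ring

/-! ### The loss of a single letter when its expected count is large -/

/-- The difference of the two sides vanishes at 1 and has derivative `(z - 1)^3 (4 - 1/z)`. Using
the coefficient 1 for the fourth power, instead of 1/4, keeps the sign right down to `y = 1/4`. -/
lemma taylor_four_le_log {y : ℝ} (hy : 1 / 4 ≤ y) :
    (y - 1) - (y - 1) ^ 2 / 2 + (y - 1) ^ 3 / 3 - (y - 1) ^ 4 ≤ Real.log y := by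
  set D : ℝ → ℝ := fun y =>
    Real.log y - ((y - 1) - (y - 1) ^ 2 / 2 + (y - 1) ^ 3 / 3 - (y - 1) ^ 4) with hD
  have hd : ∀ z : ℝ, 0 < z → HasDerivAt D ((z - 1) ^ 3 * (4 - 1 / z)) z := by
    intro z hz
    have h1 : HasDerivAt (fun y : ℝ => y - 1) 1 z := (hasDerivAt_id z).sub_const 1
    have := (Real.hasDerivAt_log hz.ne').sub
      (((h1.sub ((h1.pow 2).div_const 2)).add ((h1.pow 3).div_const 3)).sub (h1.pow 4))
    refine this.congr_deriv ?_
    field_simp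
    ring
  have hD1 : D 1 = 0 := by simp [hD]
  suffices 0 ≤ D y by simp only [hD] at this; linarith
  rw [← hD1]
  have hcont : ∀ s : Set ℝ, (∀ z ∈ s, 0 < z) → ContinuousOn D s := fun s hs z hz =>
    (hd z (hs z hz)).continuousAt.continuousWithinAt
  rcases le_total y 1 with h | h
  · refine antitoneOn_of_deriv_nonpos (convex_Icc (1 / 4 : ℝ) 1)
      (hcont _ fun z hz => by linarith [hz.1]) (fun z hz => ?_) (fun z hz => ?_)
      ⟨hy, h⟩ ⟨by norm_num, le_rfl⟩ h
    · rw [interior_Icc] at hz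
      exact (hd z (by linarith [hz.1])).differentiableAt.differentiableWithinAt
    · rw [interior_Icc] at hz
      have hz0 : 0 < z := by linarith [hz.1]
      rw [(hd z hz0).deriv]
      have h3 : (z - 1) ^ 3 ≤ 0 := Odd.pow_nonpos (by decide) (by linarith [hz.2])
      have h4 : 0 ≤ 4 - 1 / z := by
        rw [sub_nonneg, div_le_iff₀ hz0]; linarith [hz.1]
      exact mul_nonpos_of_nonpos_of_nonneg h3 h4
  · refine monotoneOn_of_deriv_nonneg (convex_Ici (1 : ℝ))
      (hcont _ fun z hz => lt_of_lt_of_le one_pos hz) (fun z hz => ?_) (fun z hz => ?_)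
      (Set.self_mem_Ici) h h
    · rw [interior_Ici] at hz
      exact (hd z (one_pos.trans hz)).differentiableAt.differentiableWithinAt
    · rw [interior_Ici] at hz
      have hz1 : 1 < z := hz
      have hz0 : 0 < z := one_pos.trans hz1
      rw [(hd z hz0).deriv]
      have h4 : 0 ≤ 4 - 1 / z := by
        rw [sub_nonneg, div_le_iff₀ hz0]; linarith
      have : 0 < z - 1 := by linarith
      positivity

/-- The value `3 / (4 x)` is the least possible `(k + 3/4) / x`. Below `1/4` the fourth power is at
least `1/4`, so the extra factor `4 log (2x)` pays for `log y ≥ -log (2x)`. -/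
lemma taylor_four_le_log_of_le {x y : ℝ} (hx : 1 ≤ x) (hy : 3 / (4 * x) ≤ y) :
    (y - 1) - (y - 1) ^ 2 / 2 + (y - 1) ^ 3 / 3 - (1 + 4 * Real.log (2 * x)) * (y - 1) ^ 4
      ≤ Real.log y := by
  have hlog : 0 ≤ Real.log (2 * x) := Real.log_nonneg (by linarith)
  have hy0 : 0 < y := lt_of_lt_of_le (by positivity) hy
  rcases le_total (1 / 4) y with h | h
  · have := taylor_four_le_log h
    have h4 : 0 ≤ 4 * Real.log (2 * x) * (y - 1) ^ 4 := by positivity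
    linarith
  · have h1 : -Real.log (2 * x) ≤ Real.log y := by
      rw [← Real.log_inv]
      refine Real.log_le_log (by positivity) (le_trans ?_ hy)
      rw [inv_eq_one_div, div_le_div_iff₀ (by positivity) (by positivity)]
      linarith
    have h2 : (1 : ℝ) / 4 ≤ (y - 1) ^ 4 := by
      have h3 : (1 : ℝ) / 2 ≤ (y - 1) ^ 2 := by nlinarith
      calc (1 : ℝ) / 4 ≤ (y - 1) ^ 2 * (y - 1) ^ 2 := by nlinarith
        _ = _ := by ring
    have h3 : (y - 1) ^ 3 ≤ 0 := Odd.pow_nonpos (by decide) (by linarith)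
    have h4 := mul_le_mul_of_nonneg_left h2 hlog
    have h5 : 0 ≤ (y - 1) ^ 4 := by positivity
    have h6 := sq_nonneg (y - 1)
    nlinarith

lemma braessSauerConst_pos (k : ℕ) : 0 < braessSauerConst k := by
  match k with
  | 0 => norm_num [braessSauerConst]
  | 1 => norm_num [braessSauerConst]
  | k + 2 => norm_num [braessSauerConst]

lemma half_le_braessSauerConst (k : ℕ) : 1 / 2 ≤ braessSauerConst k := by
  match k with
  | 0 => norm_num [braessSauerConst]
  | 1 => norm_num [braessSauerConst]
  | k + 2 => norm_num [braessSauerConst]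

lemma braessSauerConst_le_one (k : ℕ) : braessSauerConst k ≤ 1 := by
  match k with
  | 0 => norm_num [braessSauerConst]
  | 1 => norm_num [braessSauerConst]
  | k + 2 => norm_num [braessSauerConst]

/-- The (rescaled) contribution of a letter of probability `p` to the loss of the variable
add-constant estimate from a sample of size `n`. -/
noncomputable def letterLoss (n : ℕ) (p : ℝ) : ℝ :=
  binomialExp n p (fun k => braessSauerConst k - n * p * Real.log (k + braessSauerConst k))
    + n * p * Real.log (n * p)

/-- A pointwise bound whose expectation yields the second order expansion of the loss. -/
lemma braessSauer_pointwise_le {x : ℝ} (hx : 2 ≤ x) (k : ℕ) :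
    braessSauerConst k - x * Real.log (k + braessSauerConst k) + x * Real.log x
      ≤ 3 / 4 - (((k : ℝ) - x) + 3 / 4) + (((k : ℝ) - x) + 3 / 4) ^ 2 / (2 * x)
        - (((k : ℝ) - x) + 3 / 4) ^ 3 / (3 * x ^ 2)
        + (1 + 4 * Real.log (2 * x)) * (8 * ((k : ℝ) - x) ^ 4 + 8) / x ^ 3
        + (x + 1) * (16 * ((k : ℝ) - x) ^ 4 / x ^ 4) := by
  have hx0 : 0 < x := by linarith
  have hk0 : (0 : ℝ) ≤ k := k.cast_nonneg
  have hlog : 0 ≤ Real.log (2 * x) := Real.log_nonneg (by linarith)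
  set m : ℝ := (k : ℝ) - x with hm
  have hym : ((k : ℝ) + 3 / 4) / x - 1 = (m + 3 / 4) / x := by
    rw [hm]; field_simp; ring
  have h1 := taylor_four_le_log_of_le (x := x) (y := ((k : ℝ) + 3 / 4) / x) (by linarith)
    (by rw [div_le_div_iff₀ (by positivity) hx0]; nlinarith)
  rw [hym, Real.log_div (by positivity) hx0.ne'] at h1
  have h2 : (m + 3 / 4) ^ 4 ≤ 8 * m ^ 4 + 8 := by
    have e : 8 * m ^ 4 + 8 * (3 / 4) ^ 4 - (m + 3 / 4) ^ 4
      = (m - 3 / 4) ^ 2 * (7 * m ^ 2 + 10 * (3 / 4) * m + 7 * (3 / 4) ^ 2) := by ring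
    have : 0 ≤ 7 * m ^ 2 + 10 * (3 / 4) * m + 7 * (3 / 4 : ℝ) ^ 2 := by nlinarith [sq_nonneg (m + 1/2)]
    nlinarith [mul_nonneg (sq_nonneg (m - 3 / 4)) this]
  have h3 : x * ((m + 3 / 4) / x - ((m + 3 / 4) / x) ^ 2 / 2 + ((m + 3 / 4) / x) ^ 3 / 3
      - (1 + 4 * Real.log (2 * x)) * ((m + 3 / 4) / x) ^ 4)
      = (m + 3 / 4) - (m + 3 / 4) ^ 2 / (2 * x) + (m + 3 / 4) ^ 3 / (3 * x ^ 2)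
        - (1 + 4 * Real.log (2 * x)) * (m + 3 / 4) ^ 4 / x ^ 3 := by
    field_simp
  have h4 := mul_le_mul_of_nonneg_left h1 hx0.le
  rw [h3] at h4
  have h5 : (1 + 4 * Real.log (2 * x)) * (m + 3 / 4) ^ 4 / x ^ 3
      ≤ (1 + 4 * Real.log (2 * x)) * (8 * m ^ 4 + 8) / x ^ 3 := by gcongr
  -- Replacing `β_k` by `3/4` matters only for `k ≤ 1`. There `|k - x| ≥ x/2`, so the cost, at most
  -- `x + 1`, can be charged to the fourth moment as in Markov's inequality.
  have h6 : braessSauerConst k - x * Real.log (k + braessSauerConst k)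
      ≤ 3 / 4 - x * Real.log (k + 3 / 4) + (x + 1) * (16 * m ^ 4 / x ^ 4) := by
    have hbig : k ≤ 1 → 1 ≤ 16 * m ^ 4 / x ^ 4 := by
      intro hk
      have hk' : (k : ℝ) ≤ 1 := by exact_mod_cast hk
      have h7 : (x / 2) ^ 4 ≤ (-m) ^ 4 := by
        apply pow_le_pow_left₀ (by positivity)
        rw [hm]; linarith
      rw [le_div_iff₀ (by positivity)]
      have : (x / 2) ^ 4 = x ^ 4 / 16 := by ring
      have : (-m) ^ 4 = m ^ 4 := by ring
      linarith
    have hnn : 0 ≤ 16 * m ^ 4 / x ^ 4 := by positivity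
    match k with
    | 0 =>
      have hb := hbig (by norm_num)
      have h8 : Real.log (3 / 4) - Real.log (1 / 2) ≤ 1 := by
        rw [← Real.log_div (by norm_num) (by norm_num)]
        have := Real.log_le_sub_one_of_pos (x := (3 / 4 : ℝ) / (1 / 2)) (by norm_num)
        linarith
      simp only [braessSauerConst, Nat.cast_zero, zero_add]
      nlinarith [mul_le_mul_of_nonneg_left hb (by linarith : 0 ≤ x + 1)]
    | 1 =>
      have hb := hbig (by norm_num)
      have h8 : Real.log (1 + 3 / 4) ≤ Real.log (1 + 1) :=
        Real.log_le_log (by norm_num) (by norm_num)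
      simp only [braessSauerConst, Nat.cast_one]
      nlinarith [mul_le_mul_of_nonneg_left hb (by linarith : 0 ≤ x + 1)]
    | k + 2 =>
      simp only [braessSauerConst]
      nlinarith
  linarith

lemma binomial_fourth_moment_le {n : ℕ} {p x : ℝ} (h0 : 0 ≤ p) (h1 : p ≤ 1) (hx : 2 ≤ x)
    (hxdef : x = n * p) :
    x * (1 - p) * (1 + 3 * (n - 2) * p * (1 - p)) ≤ 4 * x ^ 2 := by
  have hx0 : 0 < x := by linarith
  have hq0 : 0 ≤ 1 - p := by linarith
  have e : (n - 2 : ℝ) * p = x - 2 * p := by rw [hxdef]; ring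
  have e2 : 1 + 3 * (n - 2) * p * (1 - p) = 1 + 3 * (x - 2 * p) * (1 - p) := by
    rw [← e]; ring
  rw [e2]
  have h3 : 1 + 3 * (x - 2 * p) * (1 - p) ≤ 1 + 3 * x := by nlinarith
  have h4 : x * (1 - p) ≤ x := by nlinarith
  calc _ ≤ x * (1 - p) * (1 + 3 * x) := mul_le_mul_of_nonneg_left h3 (by positivity)
    _ ≤ x * (1 + 3 * x) := mul_le_mul_of_nonneg_right h4 (by positivity)
    _ ≤ _ := by nlinarith

lemma letterLoss_remainder_le {p x C l m : ℝ} (h0 : 0 ≤ p) (h1 : p ≤ 1) (hx : 2 ≤ x)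
    (hlog : 0 ≤ l) (hC : C = 1 + 4 * l) (hm : m ≤ 4 * x ^ 2) :
    (9 / (32 * x) - 9 / (64 * x ^ 2) + 8 * C / x ^ 3)
        + (1 / (2 * x) - 3 / (4 * x ^ 2)) * (x * (1 - p))
        + (-1 / (3 * x ^ 2)) * (x * (1 - p) * (1 - 2 * p))
        + (8 * C / x ^ 3 + 16 * (x + 1) / x ^ 4) * m
      ≤ (1 - p) / 2 + (200 + 200 * l) / x := by
  have hx0 : 0 < x := by linarith
  have hC0 : 0 ≤ C := by linarith
  have hq0 : 0 ≤ 1 - p := by linarith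
  have t1 : (8 * C / x ^ 3 + 16 * (x + 1) / x ^ 4)
        * m
      ≤ (8 * C / x ^ 3 + 16 * (x + 1) / x ^ 4) * (4 * x ^ 2) :=
    mul_le_mul_of_nonneg_left hm (by positivity)
  have t2 : (-1 / (3 * x ^ 2)) * (x * (1 - p) * (1 - 2 * p)) ≤ 1 / x := by
    have : (-1 / (3 * x ^ 2)) * (x * (1 - p) * (1 - 2 * p))
      = (-(1 - p) * (1 - 2 * p) / 3) / x := by field_simp
    rw [this]
    gcongr
    nlinarith
  have t3 : (1 / (2 * x) - 3 / (4 * x ^ 2)) * (x * (1 - p)) ≤ (1 - p) / 2 := by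
    have : (1 / (2 * x) - 3 / (4 * x ^ 2)) * (x * (1 - p))
      = (1 - p) / 2 - 3 * (1 - p) / (4 * x) := by field_simp
    rw [this]
    have : 0 ≤ 3 * (1 - p) / (4 * x) := by positivity
    linarith
  have t4 : (8 * C / x ^ 3 + 16 * (x + 1) / x ^ 4) * (4 * x ^ 2)
      ≤ (32 * C + 128) / x := by
    have : (8 * C / x ^ 3 + 16 * (x + 1) / x ^ 4) * (4 * x ^ 2)
      = (32 * C + 64 + 64 / x) / x := by field_simp; ring
    rw [this]
    have : 64 / x ≤ 64 := by rw [div_le_iff₀ hx0]; nlinarith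
    exact div_le_div_of_nonneg_right (by linarith) hx0.le
  have t5 : 9 / (32 * x) - 9 / (64 * x ^ 2) + 8 * C / x ^ 3 ≤ (1 + 2 * C) / x := by
    have : 9 / (32 * x) - 9 / (64 * x ^ 2) + 8 * C / x ^ 3
      = (9 / 32 - 9 / (64 * x) + 8 * C / x ^ 2) / x := by field_simp
    rw [this]
    have a1 : 0 ≤ 9 / (64 * x) := by positivity
    have a2 : 8 * C / x ^ 2 ≤ 2 * C := by
      rw [div_le_iff₀ (by positivity)]
      nlinarith [mul_le_mul_of_nonneg_left (show (4 : ℝ) ≤ x ^ 2 by nlinarith) hC0]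
    exact div_le_div_of_nonneg_right (by linarith) hx0.le
  have t6 : (200 + 200 * l) / x
      = (32 * C + 128) / x + (1 + 2 * C) / x + 1 / x + (36 + 64 * l) / x := by
    rw [hC]; field_simp; ring
  have t7 : 0 ≤ (36 + 64 * l) / x := by positivity
  rw [t6]
  linarith

/-- In the expectation of the pointwise bound the constant `3/4` cancels, the variance gives `(1 -
p) / 2`, and all other terms are of order `log x / x`. -/
lemma letterLoss_le_of_large {n : ℕ} {p : ℝ} (h0 : 0 ≤ p) (h1 : p ≤ 1) (hx : 2 ≤ n * p) :
    letterLoss n p ≤ (1 - p) / 2 + (200 + 200 * Real.log (2 * (n * p))) / (n * p) := by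
  set x : ℝ := n * p with hxdef
  have hx0 : 0 < x := by linarith
  have hlog : 0 ≤ Real.log (2 * x) := Real.log_nonneg (by linarith)
  set C : ℝ := 1 + 4 * Real.log (2 * x) with hC
  obtain ⟨m1, m2, m3, m4⟩ := binomialExp_central_moments n p
  rw [← hxdef] at m1 m2 m3 m4
  have hexp : letterLoss n p = binomialExp n p (fun k =>
      braessSauerConst k - x * Real.log (k + braessSauerConst k) + x * Real.log x) := by
    rw [letterLoss, binomialExp_add, binomialExp_const]
  rw [hexp]
  refine (binomialExp_mono n h0 h1 (braessSauer_pointwise_le hx)).trans ?_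
  have key : ∀ c a1 a2 a3 a4 : ℝ, binomialExp n p (fun k => c + a1 * ((k : ℝ) - x)
        + a2 * ((k : ℝ) - x) ^ 2 + a3 * ((k : ℝ) - x) ^ 3 + a4 * ((k : ℝ) - x) ^ 4)
        = c + a2 * (x * (1 - p)) + a3 * (x * (1 - p) * (1 - 2 * p))
          + a4 * (x * (1 - p) * (1 + 3 * (n - 2) * p * (1 - p))) := by
    intro c a1 a2 a3 a4
    simp only [binomialExp_add, binomialExp_const_mul, m1, m2, m3, m4, binomialExp_const]
    ring
  have heq : (fun k : ℕ => 3 / 4 - (((k : ℝ) - x) + 3 / 4) + (((k : ℝ) - x) + 3 / 4) ^ 2 / (2 * x)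
        - (((k : ℝ) - x) + 3 / 4) ^ 3 / (3 * x ^ 2) + C * (8 * ((k : ℝ) - x) ^ 4 + 8) / x ^ 3
        + (x + 1) * (16 * ((k : ℝ) - x) ^ 4 / x ^ 4))
      = fun k : ℕ => (9 / (32 * x) - 9 / (64 * x ^ 2) + 8 * C / x ^ 3)
        + (-1 + 3 / (4 * x) - 9 / (16 * x ^ 2)) * ((k : ℝ) - x)
        + (1 / (2 * x) - 3 / (4 * x ^ 2)) * ((k : ℝ) - x) ^ 2
        + (-1 / (3 * x ^ 2)) * ((k : ℝ) - x) ^ 3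
        + (8 * C / x ^ 3 + 16 * (x + 1) / x ^ 4) * ((k : ℝ) - x) ^ 4 := by
    funext k; field_simp; ring
  rw [heq, key]
  exact letterLoss_remainder_le h0 h1 hx hlog hC (binomial_fourth_moment_le h0 h1 hx hxdef)

/-! ### Poisson expectations -/

/-- Sequences of at most exponential growth. -/
def ExpGrowth (a : ℕ → ℝ) : Prop := ∃ C R : ℝ, 1 ≤ R ∧ ∀ k, |a k| ≤ C * R ^ k

namespace ExpGrowth

variable {a b : ℕ → ℝ}

lemma const (c : ℝ) : ExpGrowth fun _ => c := ⟨|c|, 1, le_rfl, fun k => by simp⟩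

lemma natCast : ExpGrowth fun k => (k : ℝ) := by
  refine ⟨1, 2, by norm_num, fun k => ?_⟩
  rw [Nat.abs_cast, one_mul]
  exact_mod_cast Nat.lt_two_pow_self.le

lemma nonneg_const {C R : ℝ} (h : ∀ k, |a k| ≤ C * R ^ k) : 0 ≤ C := by
  simpa using (abs_nonneg _).trans (h 0)

lemma add (ha : ExpGrowth a) (hb : ExpGrowth b) : ExpGrowth fun k => a k + b k := by
  obtain ⟨C, R, hR, h⟩ := ha
  obtain ⟨D, S, hS, h'⟩ := hb
  have hC := nonneg_const h
  have hD := nonneg_const h'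
  refine ⟨C + D, max R S, le_max_of_le_left hR, fun k => (abs_add_le _ _).trans ?_⟩
  rw [add_mul]
  have h1 : R ^ k ≤ max R S ^ k := pow_le_pow_left₀ (by linarith) (le_max_left _ _) k
  have h2 : S ^ k ≤ max R S ^ k := pow_le_pow_left₀ (by linarith) (le_max_right _ _) k
  exact add_le_add ((h k).trans (mul_le_mul_of_nonneg_left h1 hC))
    ((h' k).trans (mul_le_mul_of_nonneg_left h2 hD))

lemma mul (ha : ExpGrowth a) (hb : ExpGrowth b) : ExpGrowth fun k => a k * b k := by
  obtain ⟨C, R, hR, h⟩ := ha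
  obtain ⟨D, S, hS, h'⟩ := hb
  have hC := nonneg_const h
  refine ⟨C * D, R * S, by nlinarith, fun k => ?_⟩
  rw [abs_mul, mul_pow, mul_mul_mul_comm]
  exact mul_le_mul (h k) (h' k) (abs_nonneg _) (by positivity)

lemma const_mul (ha : ExpGrowth a) (c : ℝ) : ExpGrowth fun k => c * a k := (const c).mul ha

lemma sub (ha : ExpGrowth a) (hb : ExpGrowth b) : ExpGrowth fun k => a k - b k := by
  simpa [sub_eq_add_neg] using ha.add (hb.const_mul (-1))

lemma shift (ha : ExpGrowth a) : ExpGrowth fun k => a (k + 1) := by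
  obtain ⟨C, R, hR, h⟩ := ha
  exact ⟨C * R, R, hR, fun k => (h (k + 1)).trans_eq (by ring)⟩

lemma shift_back (ha : ExpGrowth a) : ExpGrowth fun k => a (k - 1) := by
  obtain ⟨C, R, hR, h⟩ := ha
  exact ⟨C, R, hR, fun k => (h (k - 1)).trans
    (mul_le_mul_of_nonneg_left (pow_le_pow_right₀ hR (Nat.sub_le _ _)) (nonneg_const h))⟩

lemma summable_bound (ha : ExpGrowth a) (r : ℝ) :
    Summable fun k : ℕ => |a k| * |r| ^ k / k.factorial := by
  obtain ⟨C, R, hR, h⟩ := ha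
  refine Summable.of_nonneg_of_le (fun k => by positivity) (fun k => ?_)
    ((Real.summable_pow_div_factorial (R * |r|)).mul_left C)
  rw [mul_pow, ← mul_div_assoc, ← mul_assoc]
  have := h k
  gcongr

lemma summable (ha : ExpGrowth a) (x : ℝ) :
    Summable fun k : ℕ => a k * x ^ k / k.factorial := by
  refine Summable.of_norm ?_
  simpa [abs_mul, abs_div, abs_pow] using ha.summable_bound x

end ExpGrowth

/-- The expectation of `a N` for a Poisson variable `N` with parameter `x`. -/
noncomputable def poissonExp (x : ℝ) (a : ℕ → ℝ) : ℝ :=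
  Real.exp (-x) * ∑' k : ℕ, a k * x ^ k / k.factorial

section

variable {a b : ℕ → ℝ} {x : ℝ}

lemma poissonExp_const (x c : ℝ) : poissonExp x (fun _ => c) = c := by
  have : ∑' k : ℕ, c * x ^ k / k.factorial = c * Real.exp x := by
    simp only [mul_div_assoc, tsum_mul_left]
    rw [Real.exp_eq_exp_ℝ, NormedSpace.exp_eq_tsum_div]
  rw [poissonExp, this, mul_left_comm, ← Real.exp_add]
  simp

lemma poissonExp_add (ha : ExpGrowth a) (hb : ExpGrowth b) :
    poissonExp x (fun k => a k + b k) = poissonExp x a + poissonExp x b := by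
  simp only [poissonExp, add_mul, add_div]
  rw [(ha.summable x).tsum_add (hb.summable x), mul_add]

lemma poissonExp_const_mul (c : ℝ) : poissonExp x (fun k => c * a k) = c * poissonExp x a := by
  simp only [poissonExp, mul_assoc, mul_div_assoc, tsum_mul_left]
  ring

lemma poissonExp_sub (ha : ExpGrowth a) (hb : ExpGrowth b) :
    poissonExp x (fun k => a k - b k) = poissonExp x a - poissonExp x b := by
  have := poissonExp_add (x := x) ha (hb.const_mul (-1))
  rw [poissonExp_const_mul] at this
  simpa [sub_eq_add_neg] using this

lemma poissonExp_mono (hx : 0 ≤ x) (ha : ExpGrowth a) (hb : ExpGrowth b) (h : ∀ k, a k ≤ b k) :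
    poissonExp x a ≤ poissonExp x b := by
  refine mul_le_mul_of_nonneg_left
    ((ha.summable x).tsum_le_tsum (fun k => ?_) (hb.summable x)) (Real.exp_pos _).le
  have := h k
  gcongr

/-- The Stein–Chen identity `E[N a(N - 1)] = x E[a(N)]`. It absorbs prefactors `x` into the
sequence, so that derivatives in `x` become plain differences. -/
lemma poissonExp_natCast_mul (ha : ExpGrowth a) :
    poissonExp x (fun k => k * a (k - 1)) = x * poissonExp x a := by
  rw [poissonExp, poissonExp,
    ((ExpGrowth.natCast.mul ha.shift_back).summable x).tsum_eq_zero_add]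
  simp only [Nat.cast_zero, zero_mul, zero_div, zero_add, Nat.add_sub_cancel]
  rw [mul_left_comm]
  congr 1
  rw [← tsum_mul_left]
  refine tsum_congr fun k => ?_
  rw [Nat.factorial_succ]
  push_cast
  field_simp
  ring

lemma poissonExp_natCast (x : ℝ) : poissonExp x (fun k => (k : ℝ)) = x := by
  simpa [poissonExp_const] using poissonExp_natCast_mul (x := x) (ExpGrowth.const 1)

lemma hasDerivAt_tsum_pow_div_factorial (ha : ExpGrowth a) (x : ℝ) :
    HasDerivAt (fun y : ℝ => ∑' k : ℕ, a k * y ^ k / k.factorial)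
      (∑' k : ℕ, a (k + 1) * x ^ k / k.factorial) x := by
  set r : ℝ := |x| + 1 with hr
  have hr0 : 0 ≤ r := by positivity
  have hsum : Summable fun k : ℕ => |(k : ℝ) * a k| * r ^ (k - 1) / k.factorial := by
    rw [← summable_nat_add_iff 1]
    refine (ha.shift.summable_bound r).congr fun k => ?_
    rw [abs_mul, Nat.abs_cast, Nat.factorial_succ, abs_of_nonneg hr0, Nat.add_sub_cancel]
    push_cast
    field_simp
  have h := hasDerivAt_tsum_of_isPreconnected (t := Metric.ball (0 : ℝ) r) (y₀ := 0) (y := x)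
    (g := fun (k : ℕ) y => a k * y ^ k / k.factorial)
    (g' := fun (k : ℕ) y => a k * (k * y ^ (k - 1)) / k.factorial)
    hsum Metric.isOpen_ball
    (convex_ball (0 : ℝ) r).isPreconnected
    (fun k y _ => ((hasDerivAt_pow k y).const_mul (a k)).div_const _)
    (fun k y hy => ?_) (Metric.mem_ball_self (by positivity)) (ha.summable 0)
    (by rw [mem_ball_zero_iff, Real.norm_eq_abs]; linarith)
  · refine h.congr_deriv ?_
    have hs : Summable fun k : ℕ => a k * (k * x ^ (k - 1)) / k.factorial := by
      rw [← summable_nat_add_iff 1]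
      refine (ha.shift.summable x).congr fun k => ?_
      rw [Nat.factorial_succ, Nat.add_sub_cancel]
      push_cast
      field_simp
    rw [hs.tsum_eq_zero_add]
    simp only [Nat.cast_zero, zero_mul, mul_zero, zero_div, zero_add, Nat.add_sub_cancel]
    refine tsum_congr fun k => ?_
    rw [Nat.factorial_succ]
    push_cast
    field_simp
  · rw [mem_ball_zero_iff, Real.norm_eq_abs] at hy
    rw [Real.norm_eq_abs, abs_div, ← mul_assoc, abs_mul, abs_pow, Nat.abs_cast, mul_comm (a k)]
    have := hy.le
    gcongr

lemma hasDerivAt_poissonExp (ha : ExpGrowth a) (x : ℝ) :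
    HasDerivAt (fun y => poissonExp y a) (poissonExp x fun k => a (k + 1) - a k) x := by
  have h1 : HasDerivAt (fun y : ℝ => Real.exp (-y)) (-Real.exp (-x)) x := by
    simpa using (hasDerivAt_id x).neg.exp
  refine (h1.mul (hasDerivAt_tsum_pow_div_factorial ha x)).congr_deriv ?_
  rw [poissonExp_sub ha.shift ha, poissonExp, poissonExp]
  ring

/-- Poisson expectation of a sequence that is bounded below by an affine one from `K` on. -/
lemma le_poissonExp_of_affine_le (hx : 0 ≤ x) (ha : ExpGrowth a) {c s : ℝ} {K : ℕ}
    (h : ∀ k, K ≤ k → c + s * k ≤ a k) :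
    c + s * x + Real.exp (-x) * ∑ k ∈ Finset.range K, (a k - (c + s * k)) * x ^ k / k.factorial
      ≤ poissonExp x a := by
  have hl : ExpGrowth fun k => c + s * (k : ℝ) :=
    (ExpGrowth.const c).add (ExpGrowth.natCast.const_mul s)
  have h1 : poissonExp x (fun k => c + s * (k : ℝ)) = c + s * x := by
    rw [poissonExp_add (ExpGrowth.const c) (ExpGrowth.natCast.const_mul s), poissonExp_const,
      poissonExp_const_mul, poissonExp_natCast]
  have h2 := poissonExp_sub (x := x) ha hl
  have h3 : Real.exp (-x) * ∑ k ∈ Finset.range K, (a k - (c + s * k)) * x ^ k / k.factorial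
      ≤ poissonExp x (fun k => a k - (c + s * (k : ℝ))) := by
    refine mul_le_mul_of_nonneg_left (((ha.sub hl).summable x).sum_le_tsum _ fun k hk => ?_)
      (Real.exp_pos _).le
    have hk' := h k (by simpa using hk)
    have : 0 ≤ a k - (c + s * k) := by linarith
    positivity
  linarith

end

/-! ### The Poisson limit of the loss of a letter -/

lemma abs_log_natCast_add_braessSauerConst_le (k : ℕ) :
    |Real.log (k + braessSauerConst k)| ≤ k + 1 := by
  have hk : (0 : ℝ) ≤ k := k.cast_nonneg
  have h1 := half_le_braessSauerConst k
  have h2 := braessSauerConst_le_one k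
  rw [abs_le]
  constructor
  · have : 1 - ((k : ℝ) + braessSauerConst k)⁻¹ ≤ Real.log (k + braessSauerConst k) :=
      Real.one_sub_inv_le_log_of_pos (by linarith)
    have h3 : ((k : ℝ) + braessSauerConst k)⁻¹ ≤ (1 / 2)⁻¹ := by
      apply inv_anti₀ (by norm_num); linarith
    norm_num at h3
    linarith
  · have := Real.log_le_sub_one_of_pos (x := (k : ℝ) + braessSauerConst k) (by linarith)
    linarith

lemma expGrowth_braessSauerConst : ExpGrowth braessSauerConst :=
  ⟨1, 1, le_rfl, fun k => by
    rw [abs_of_pos (braessSauerConst_pos k)]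
    simpa using braessSauerConst_le_one k⟩

lemma expGrowth_log : ExpGrowth fun k => Real.log (k + braessSauerConst k) := by
  refine ⟨1, 2, by norm_num, fun k => (abs_log_natCast_add_braessSauerConst_le k).trans ?_⟩
  rw [one_mul]
  exact_mod_cast Nat.lt_two_pow_self

/-- The sequence whose Poisson expectation is `x E log (N + β_N) - E β_N`. -/
noncomputable def braessSauerSeq (k : ℕ) : ℝ :=
  k * Real.log ((k - 1 : ℕ) + braessSauerConst (k - 1)) - braessSauerConst k

lemma expGrowth_braessSauerSeq : ExpGrowth braessSauerSeq :=
  (ExpGrowth.natCast.mul expGrowth_log.shift_back).sub expGrowth_braessSauerConst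

/-- Half minus the Poisson limit of `letterLoss n (x / n)`. -/
noncomputable def poissonGap (x : ℝ) : ℝ :=
  poissonExp x braessSauerSeq - x * Real.log x + 1 / 2

lemma poissonExp_braessSauerSeq (x : ℝ) :
    poissonExp x braessSauerSeq = x * poissonExp x (fun k => Real.log (k + braessSauerConst k))
      - poissonExp x braessSauerConst := by
  have h := poissonExp_sub (x := x) (ExpGrowth.natCast.mul expGrowth_log.shift_back)
    expGrowth_braessSauerConst
  rw [poissonExp_natCast_mul expGrowth_log] at h
  exact h

/-! ### Joint convergence of the binomial law to the Poisson law -/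

lemma binomialExp_eq_tsum (n : ℕ) (p : ℝ) (F : ℕ → ℝ) :
    binomialExp n p F = ∑' k, (n.choose k : ℝ) * p ^ k * (1 - p) ^ (n - k) * F k := by
  rw [binomialExp, tsum_eq_sum]
  intro k hk
  rw [Nat.choose_eq_zero_of_lt (by simpa using hk)]
  simp

section

variable {x M : ℝ}

/-- Limits are taken along `n → ∞` and `y → x` within `[0, M]` simultaneously. Joint convergence is
local uniformity in `y`, which compactness later turns into uniformity on `[0, M]`. -/
lemma tendsto_fst_atTop_prod {l : Filter ℝ} :
    Tendsto (fun q : ℕ × ℝ => (q.1 : ℝ)) (atTop ×ˢ l) atTop :=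
  tendsto_natCast_atTop_atTop.comp tendsto_fst

lemma tendsto_snd_nhdsWithin_prod :
    Tendsto (fun q : ℕ × ℝ => q.2) (atTop ×ˢ nhdsWithin x (Set.Icc 0 M)) (nhds x) :=
  tendsto_nhdsWithin_iff.1 tendsto_snd |>.1

lemma eventually_mem_prod :
    ∀ᶠ q : ℕ × ℝ in atTop ×ˢ nhdsWithin x (Set.Icc 0 M), q.2 ∈ Set.Icc 0 M :=
  tendsto_snd.eventually self_mem_nhdsWithin

lemma tendsto_div_prod : Tendsto (fun q : ℕ × ℝ => q.2 / q.1)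
    (atTop ×ˢ nhdsWithin x (Set.Icc 0 M)) (nhds 0) :=
  tendsto_snd_nhdsWithin_prod.div_atTop tendsto_fst_atTop_prod

/-- Squeeze with `1 - 1/z ≤ log z` from below and `1 - u ≤ exp (-u)` from above. -/
lemma tendsto_one_sub_div_pow_prod : Tendsto (fun q : ℕ × ℝ => (1 - q.2 / q.1) ^ q.1)
    (atTop ×ˢ nhdsWithin x (Set.Icc 0 M)) (nhds (Real.exp (-x))) := by
  have hy := tendsto_snd_nhdsWithin_prod (x := x) (M := M)
  have hp := tendsto_div_prod (x := x) (M := M)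
  have hlow : Tendsto (fun q : ℕ × ℝ => Real.exp (-(q.2 / (1 - q.2 / q.1))))
      (atTop ×ˢ nhdsWithin x (Set.Icc 0 M)) (nhds (Real.exp (-x))) := by
    refine (Real.continuous_exp.tendsto _).comp (Tendsto.neg ?_)
    have h := hy.div (hp.const_sub 1) (by norm_num)
    rw [sub_zero, div_one] at h
    exact h
  have hup : Tendsto (fun q : ℕ × ℝ => Real.exp (-q.2))
      (atTop ×ˢ nhdsWithin x (Set.Icc 0 M)) (nhds (Real.exp (-x))) :=
    (Real.continuous_exp.tendsto _).comp hy.neg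
  have hn : ∀ᶠ q : ℕ × ℝ in atTop ×ˢ nhdsWithin x (Set.Icc 0 M), 1 ≤ q.1 :=
    tendsto_fst.eventually (eventually_ge_atTop 1)
  have hlt := hp.eventually (gt_mem_nhds (show (0 : ℝ) < 1 by norm_num))
  refine tendsto_of_tendsto_of_tendsto_of_le_of_le' hlow hup ?_ ?_
  · filter_upwards [hn, hlt] with q h1 h2
    have hq : (0 : ℝ) < q.1 := by exact_mod_cast h1
    have hpos : 0 < 1 - q.2 / q.1 := by linarith
    have h3 := Real.one_sub_inv_le_log_of_pos hpos
    have h4 : -(q.2 / (1 - q.2 / q.1)) = q.1 * (1 - (1 - q.2 / q.1)⁻¹) := by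
      have h5 : q.2 = q.1 * (q.2 / q.1) := by field_simp
      generalize q.2 / q.1 = p at *
      rw [h5]
      field_simp
      ring
    rw [h4, Real.exp_nat_mul]
    refine pow_le_pow_left₀ (Real.exp_pos _).le ?_ _
    rw [← Real.le_log_iff_exp_le hpos]
    exact h3
  · filter_upwards [hn, hlt] with q h1 h2
    have hq : (0 : ℝ) < q.1 := by exact_mod_cast h1
    have h4 : -q.2 = q.1 * (-(q.2 / q.1)) := by field_simp
    rw [h4, Real.exp_nat_mul]
    exact pow_le_pow_left₀ (by linarith) (Real.one_sub_le_exp_neg _) _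

lemma tendsto_binomial_weight_prod (k : ℕ) :
    Tendsto (fun q : ℕ × ℝ =>
        (q.1.choose k : ℝ) * (q.2 / q.1) ^ k * (1 - q.2 / q.1) ^ (q.1 - k))
      (atTop ×ˢ nhdsWithin x (Set.Icc 0 M))
      (nhds (Real.exp (-x) * (x ^ k / k.factorial))) := by
  have hp := tendsto_div_prod (x := x) (M := M)
  have h1 : Tendsto (fun q : ℕ × ℝ => (q.1.choose k : ℝ) * (1 / (q.1 : ℝ)) ^ k)
      (atTop ×ˢ nhdsWithin x (Set.Icc 0 M)) (nhds (1 / k.factorial)) := by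
    have := ProbabilityTheory.tendsto_choose_mul_pow_atTop (p := fun n : ℕ => 1 / (n : ℝ))
      (r := 1) k (tendsto_const_nhds.congr' (by
        filter_upwards [eventually_ge_atTop 1] with n hn
        have : (n : ℝ) ≠ 0 := by positivity
        field_simp))
    rw [one_pow] at this
    exact this.comp tendsto_fst
  have h2 : Tendsto (fun q : ℕ × ℝ => q.2 ^ k)
      (atTop ×ˢ nhdsWithin x (Set.Icc 0 M)) (nhds (x ^ k)) :=
    tendsto_snd_nhdsWithin_prod.pow k
  have h3 : Tendsto (fun q : ℕ × ℝ => (1 - q.2 / q.1) ^ q.1 / (1 - q.2 / q.1) ^ k)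
      (atTop ×ˢ nhdsWithin x (Set.Icc 0 M)) (nhds (Real.exp (-x))) := by
    have h := tendsto_one_sub_div_pow_prod.div ((hp.const_sub 1).pow k) (by norm_num)
    rw [sub_zero, one_pow, div_one] at h
    exact h
  have h4 := (h1.mul h2).mul h3
  rw [show 1 / (k.factorial : ℝ) * x ^ k * Real.exp (-x)
    = Real.exp (-x) * (x ^ k / k.factorial) by ring] at h4
  refine h4.congr' ?_
  have hn : ∀ᶠ q : ℕ × ℝ in atTop ×ˢ nhdsWithin x (Set.Icc 0 M), k ≤ q.1 :=
    tendsto_fst.eventually (eventually_ge_atTop k)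
  have hlt := hp.eventually (gt_mem_nhds (show (0 : ℝ) < 1 by norm_num))
  filter_upwards [hn, hlt] with q h5 h6
  rw [pow_sub₀ _ (by linarith) h5, div_pow, div_pow, one_pow]
  ring

/-- Dominated convergence for the series over `k`: the weights are at most `M^k / k!` and the
summand at most `1 + M (k + 1)`, uniformly in `n` and `y`. -/
lemma tendsto_letterLoss_prod : Tendsto (fun q : ℕ × ℝ => letterLoss q.1 (q.2 / q.1))
    (atTop ×ˢ nhdsWithin x (Set.Icc 0 M)) (nhds (1 / 2 - poissonGap x)) := by
  have hy := tendsto_snd_nhdsWithin_prod (x := x) (M := M)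
  have hn : ∀ᶠ q : ℕ × ℝ in atTop ×ˢ nhdsWithin x (Set.Icc 0 M), 1 ≤ q.1 :=
    tendsto_fst.eventually (eventually_ge_atTop 1)
  have hlt := (tendsto_div_prod (x := x) (M := M)).eventually
    (gt_mem_nhds (show (0 : ℝ) < 1 by norm_num))
  have hgrow : ExpGrowth fun k : ℕ => 1 + M * ((k : ℝ) + 1) :=
    (ExpGrowth.const 1).add ((ExpGrowth.natCast.add (ExpGrowth.const 1)).const_mul M)
  have hmain := tendsto_tsum_of_dominated_convergence
    (f := fun (q : ℕ × ℝ) (k : ℕ) =>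
      (q.1.choose k : ℝ) * (q.2 / q.1) ^ k * (1 - q.2 / q.1) ^ (q.1 - k)
        * (braessSauerConst k - q.2 * Real.log (k + braessSauerConst k)))
    (g := fun k => Real.exp (-x) * (x ^ k / k.factorial)
      * (braessSauerConst k - x * Real.log (k + braessSauerConst k)))
    (𝓕 := atTop ×ˢ nhdsWithin x (Set.Icc 0 M)) (hgrow.summable_bound M)
    (fun k => (tendsto_binomial_weight_prod k).mul
      (tendsto_const_nhds.sub (hy.mul_const _)))
    (by
      filter_upwards [hn, hlt, eventually_mem_prod] with q h1 h2 h3 k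
      have hq : (0 : ℝ) < q.1 := by exact_mod_cast h1
      have hy0 : 0 ≤ q.2 := h3.1
      have hM : 0 ≤ M := hy0.trans h3.2
      have hp0 : 0 ≤ q.2 / q.1 := by positivity
      have hk : (0 : ℝ) ≤ k := k.cast_nonneg
      have b1 : (1 - q.2 / q.1) ^ (q.1 - k) ≤ 1 := pow_le_one₀ (by linarith) (by linarith)
      have b2 : (q.1.choose k : ℝ) * (q.2 / q.1) ^ k ≤ M ^ k / k.factorial := by
        calc (q.1.choose k : ℝ) * (q.2 / q.1) ^ k
            ≤ ((q.1 : ℝ) ^ k / k.factorial) * (q.2 / q.1) ^ k := by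
              gcongr; exact Nat.choose_le_pow_div k q.1
          _ = q.2 ^ k / k.factorial := by rw [div_pow]; field_simp
          _ ≤ _ := by gcongr; exact h3.2
      have b3 : |braessSauerConst k - q.2 * Real.log (k + braessSauerConst k)|
          ≤ 1 + M * ((k : ℝ) + 1) := by
        refine (abs_sub _ _).trans (add_le_add ?_ ?_)
        · rw [abs_of_pos (braessSauerConst_pos k)]; exact braessSauerConst_le_one k
        · rw [abs_mul, abs_of_nonneg hy0]
          exact mul_le_mul h3.2 (abs_log_natCast_add_braessSauerConst_le k) (abs_nonneg _) hM
      have hpow : 0 ≤ (1 - q.2 / q.1) ^ (q.1 - k) := pow_nonneg (by linarith) _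
      rw [Real.norm_eq_abs, abs_mul, abs_of_nonneg (by positivity), abs_of_nonneg hM,
        abs_of_nonneg (show 0 ≤ 1 + M * ((k : ℝ) + 1) by positivity), mul_div_assoc, mul_comm]
      refine mul_le_mul b3 ?_ (by positivity) (by positivity)
      calc _ ≤ (M ^ k / k.factorial) * 1 := mul_le_mul b2 b1 hpow (by positivity)
        _ = _ := mul_one _)
  have hlim : ∑' k : ℕ, Real.exp (-x) * (x ^ k / k.factorial)
      * (braessSauerConst k - x * Real.log (k + braessSauerConst k))
      = - poissonExp x braessSauerSeq := by
    have h1 := poissonExp_sub (x := x) expGrowth_braessSauerConst (expGrowth_log.const_mul x)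
    rw [poissonExp_const_mul] at h1
    rw [poissonExp_braessSauerSeq, neg_sub, ← h1, poissonExp, ← tsum_mul_left]
    exact tsum_congr fun k => by ring
  rw [hlim] at hmain
  have hxlog : Tendsto (fun q : ℕ × ℝ => q.2 * Real.log q.2)
      (atTop ×ˢ nhdsWithin x (Set.Icc 0 M)) (nhds (x * Real.log x)) :=
    (Real.continuous_mul_log.tendsto x).comp hy
  have h := hmain.add hxlog
  rw [show - poissonExp x braessSauerSeq + x * Real.log x = 1 / 2 - poissonGap x by
    rw [poissonGap]; ring] at h
  refine h.congr' ?_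
  filter_upwards [hn] with q h1
  have hq : (0 : ℝ) < q.1 := by exact_mod_cast h1
  have h2 : (q.1 : ℝ) * (q.2 / q.1) = q.2 := by field_simp
  rw [letterLoss, h2, binomialExp_eq_tsum]

lemma tendsto_letterLoss (hx : 0 ≤ x) :
    Tendsto (fun n : ℕ => letterLoss n (x / n)) atTop (nhds (1 / 2 - poissonGap x)) := by
  have hmem : Tendsto (fun _ : ℕ => x) atTop (nhdsWithin x (Set.Icc 0 x)) :=
    tendsto_nhdsWithin_iff.2 ⟨tendsto_const_nhds, Eventually.of_forall fun _ => ⟨hx, le_rfl⟩⟩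
  have h : Tendsto (fun n : ℕ => (n, x)) atTop (atTop ×ˢ nhdsWithin x (Set.Icc 0 x)) :=
    tendsto_id.prodMk hmem
  have h2 := (tendsto_letterLoss_prod (x := x) (M := x)).comp h
  simpa only [Function.comp_def] using h2

lemma eventually_forall_letterLoss_lt (hgap : ∀ x, 0 ≤ x → 0 ≤ poissonGap x) {η : ℝ}
    (hη : 0 < η) (M : ℝ) :
    ∀ᶠ n : ℕ in atTop, ∀ y ∈ Set.Icc 0 M, letterLoss n (y / n) < 1 / 2 + η := by
  refine (isCompact_Icc (a := (0 : ℝ)) (b := M)).induction_on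
    (p := fun S => ∀ᶠ n : ℕ in atTop, ∀ y ∈ S, letterLoss n (y / n) < 1 / 2 + η) (by simp)
    (fun s t hst h => h.mono fun n hn y hy => hn y (hst hy))
    (fun s t hs ht => by
      filter_upwards [hs, ht] with n h1 h2 y hy
      exact hy.elim (h1 y) (h2 y)) fun x hx => ?_
  have h := tendsto_letterLoss_prod (x := x) (M := M)
  have h2 := h.eventually (gt_mem_nhds
    (show 1 / 2 - poissonGap x < 1 / 2 + η by linarith [hgap x hx.1]))
  obtain ⟨pa, hpa, pb, hpb, h3⟩ := eventually_prod_iff.1 h2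
  exact ⟨{y | pb y}, hpb, hpa.mono fun n hn y hy => h3 hn hy⟩

/-- Limit `n → ∞` of `letterLoss_le_of_large` at `p = x / n`. It controls the gap from below at
infinity. -/
lemma neg_le_poissonGap (hx : 2 ≤ x) : -((200 + 200 * Real.log (2 * x)) / x) ≤ poissonGap x := by
  have hx0 : 0 < x := by linarith
  have h1 := tendsto_letterLoss hx0.le
  have h2 : Tendsto (fun n : ℕ => (1 - x / n) / 2 + (200 + 200 * Real.log (2 * x)) / x) atTop
      (nhds ((1 - 0) / 2 + (200 + 200 * Real.log (2 * x)) / x)) :=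
    (((tendsto_const_nhds.div_atTop tendsto_natCast_atTop_atTop).const_sub 1).div_const 2).add_const _
  have h3 := le_of_tendsto_of_tendsto h1 h2 (by
    filter_upwards [eventually_ge_atTop 1, eventually_ge_atTop ⌈x⌉₊] with n hn1 hn
    have hq : (0 : ℝ) < n := by exact_mod_cast hn1
    have hxn : x ≤ n := (Nat.le_ceil x).trans (by exact_mod_cast hn)
    have h4 : (n : ℝ) * (x / n) = x := by field_simp
    have := letterLoss_le_of_large (n := n) (p := x / n) (by positivity)
      ((div_le_one hq).2 hxn) (by rw [h4]; exact hx)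
    rwa [h4] at this)
  linarith

/-- Comes from `log z ≤ z - 1` at `(N + β_N) / x`. Only boundedness matters: a convex function
bounded above on a half-line is nonincreasing there. -/
lemma poissonGap_le (hx : 0 < x) : poissonGap x ≤ 3 / 2 := by
  have h1 : poissonExp x (fun k => Real.log (k + braessSauerConst k))
      ≤ poissonExp x (fun k => (Real.log x + 1 / x - 1) + 1 / x * (k : ℝ)) := by
    refine poissonExp_mono hx.le expGrowth_log
      ((ExpGrowth.const _).add (ExpGrowth.natCast.const_mul _)) fun k => ?_
    have hb := braessSauerConst_pos k
    have hk : (0 : ℝ) ≤ k := k.cast_nonneg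
    have h2 := Real.log_le_sub_one_of_pos (x := ((k : ℝ) + braessSauerConst k) / x) (by positivity)
    rw [Real.log_div (by positivity) hx.ne'] at h2
    have h3 : ((k : ℝ) + braessSauerConst k) / x ≤ (k + 1) / x := by
      gcongr; exact braessSauerConst_le_one k
    have h4 : ((k : ℝ) + 1) / x = 1 / x + 1 / x * k := by ring
    linarith
  rw [poissonExp_add (ExpGrowth.const _) (ExpGrowth.natCast.const_mul _), poissonExp_const,
    poissonExp_const_mul, poissonExp_natCast] at h1
  have h2 : 0 ≤ poissonExp x braessSauerConst := by
    have := poissonExp_mono hx.le (ExpGrowth.const 0) expGrowth_braessSauerConst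
      fun k => (braessSauerConst_pos k).le
    rwa [poissonExp_const] at this
  have h3 := mul_le_mul_of_nonneg_left h1 hx.le
  have h4 : x * (Real.log x + 1 / x - 1 + 1 / x * x) = x * Real.log x + 1 := by
    field_simp; ring
  rw [poissonGap, poissonExp_braessSauerSeq]
  linarith

end

/-! ### Numerical bounds -/

lemma log_ratio_bounds {y : ℝ} (h0 : 0 ≤ y) (h1 : y < 1) :
    2 * (y + y ^ 3 / 3 + y ^ 5 / 5) ≤ Real.log (1 + y) - Real.log (1 - y) ∧
    Real.log (1 + y) - Real.log (1 - y) ≤ 2 * (y + y ^ 3 / 3 + y ^ 5 / 5 + y ^ 7 / (1 - y ^ 2)) := by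
  have h2 := Real.sum_range_le_log_div h0 h1 3
  have h3 := Real.log_div_le_sum_range_add h0 h1 3
  rw [Real.log_div (by linarith) (by linarith)] at h2 h3
  norm_num [Finset.sum_range_succ] at h2 h3
  constructor <;> linarith

/-- Bounds for `log (m / (m - 1))` through the series of the inverse hyperbolic tangent. -/
lemma log_succ_sub_log_bounds {m y : ℝ} (hm : 1 < m) (hy : y = 1 / (2 * m - 1)) :
    2 * (y + y ^ 3 / 3 + y ^ 5 / 5) ≤ Real.log m - Real.log (m - 1) ∧
    Real.log m - Real.log (m - 1) ≤ 2 * (y + y ^ 3 / 3 + y ^ 5 / 5 + y ^ 7 / (1 - y ^ 2)) := by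
  have h0 : 0 < 2 * m - 1 := by linarith
  have hy1 : y < 1 := by rw [hy, div_lt_one h0]; linarith
  have h := log_ratio_bounds (y := y) (by rw [hy]; positivity) hy1
  have e1 : 1 + y = m * (2 / (2 * m - 1)) := by rw [hy]; field_simp; ring
  have e2 : 1 - y = (m - 1) * (2 / (2 * m - 1)) := by rw [hy]; field_simp; ring
  rw [e1, e2, Real.log_mul (by linarith) (by positivity), Real.log_mul (by linarith) (by positivity)]
    at h
  constructor <;> linarith [h.1, h.2]

lemma log_three_bounds : 1.0986122 ≤ Real.log 3 ∧ Real.log 3 ≤ 1.0986125 := by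
  have h := log_succ_sub_log_bounds (m := 9) (y := 1 / 17) (by norm_num) (by norm_num)
  rw [show (9 : ℝ) = 3 ^ 2 by norm_num, show (3 : ℝ) ^ 2 - 1 = 2 ^ 3 by norm_num,
    Real.log_pow, Real.log_pow] at h
  norm_num at h
  constructor <;> linarith [h.1, h.2, Real.log_two_gt_d9, Real.log_two_lt_d9]

/-- The values `braessSauerSeq k` for `3 ≤ k ≤ 10` need the logarithms of `4k - 1`, that is of 11,
15, 19, …, 39. Each bound comes from a pair of consecutive integers whose other prime factors are
already treated, here `15` and `16`. -/
lemma log_five_bounds : 1.6094376 ≤ Real.log 5 ∧ Real.log 5 ≤ 1.6094382 := by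
  have h := log_succ_sub_log_bounds (m := 16) (y := 1 / 31) (by norm_num) (by norm_num)
  rw [show (16 : ℝ) - 1 = 3 * 5 by norm_num, show (16 : ℝ) = 2 ^ 4 by norm_num,
    Real.log_pow, Real.log_mul (by norm_num) (by norm_num)] at h
  norm_num at h
  obtain ⟨h3, h3'⟩ := log_three_bounds
  constructor <;> linarith [h.1, h.2, Real.log_two_gt_d9, Real.log_two_lt_d9]

lemma log_eleven_bounds : 2.397894 ≤ Real.log 11 ∧ Real.log 11 ≤ 2.397896 := by
  have h := log_succ_sub_log_bounds (m := 33) (y := 1 / 65) (by norm_num) (by norm_num)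
  rw [show (33 : ℝ) - 1 = 2 ^ 5 by norm_num, show (33 : ℝ) = 3 * 11 by norm_num,
    Real.log_pow, Real.log_mul (by norm_num) (by norm_num)] at h
  norm_num at h
  obtain ⟨h3, h3'⟩ := log_three_bounds
  constructor <;> linarith [h.1, h.2, Real.log_two_gt_d9, Real.log_two_lt_d9]

lemma log_nineteen_bounds : 2.944438 ≤ Real.log 19 ∧ Real.log 19 ≤ 2.94444 := by
  have h := log_succ_sub_log_bounds (m := 19) (y := 1 / 37) (by norm_num) (by norm_num)
  rw [show (19 : ℝ) - 1 = 2 * 3 ^ 2 by norm_num, Real.log_mul (by norm_num) (by norm_num),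
    Real.log_pow] at h
  norm_num at h
  obtain ⟨h3, h3'⟩ := log_three_bounds
  constructor <;> linarith [h.1, h.2, Real.log_two_gt_d9, Real.log_two_lt_d9]

lemma log_twentythree_bounds : 3.135493 ≤ Real.log 23 ∧ Real.log 23 ≤ 3.135495 := by
  have h := log_succ_sub_log_bounds (m := 24) (y := 1 / 47) (by norm_num) (by norm_num)
  rw [show (24 : ℝ) - 1 = 23 by norm_num, show (24 : ℝ) = 2 ^ 3 * 3 by norm_num,
    Real.log_mul (by norm_num) (by norm_num), Real.log_pow] at h
  norm_num at h
  obtain ⟨h3, h3'⟩ := log_three_bounds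
  constructor <;> linarith [h.1, h.2, Real.log_two_gt_d9, Real.log_two_lt_d9]

lemma log_thirtyone_bounds : 3.433986 ≤ Real.log 31 ∧ Real.log 31 ≤ 3.433988 := by
  have h := log_succ_sub_log_bounds (m := 32) (y := 1 / 63) (by norm_num) (by norm_num)
  rw [show (32 : ℝ) - 1 = 31 by norm_num, show (32 : ℝ) = 2 ^ 5 by norm_num, Real.log_pow] at h
  norm_num at h
  constructor <;> linarith [h.1, h.2, Real.log_two_gt_d9, Real.log_two_lt_d9]

lemma log_thirtyfive_bounds : 3.555347 ≤ Real.log 35 ∧ Real.log 35 ≤ 3.555349 := by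
  have h := log_succ_sub_log_bounds (m := 36) (y := 1 / 71) (by norm_num) (by norm_num)
  rw [show (36 : ℝ) - 1 = 35 by norm_num, show (36 : ℝ) = 2 ^ 2 * 3 ^ 2 by norm_num,
    Real.log_mul (by norm_num) (by norm_num), Real.log_pow, Real.log_pow] at h
  norm_num at h
  obtain ⟨h3, h3'⟩ := log_three_bounds
  constructor <;> linarith [h.1, h.2, Real.log_two_gt_d9, Real.log_two_lt_d9]

lemma log_thirtynine_bounds : 3.66356 ≤ Real.log 39 ∧ Real.log 39 ≤ 3.663563 := by
  have h := log_succ_sub_log_bounds (m := 40) (y := 1 / 79) (by norm_num) (by norm_num)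
  rw [show (40 : ℝ) - 1 = 39 by norm_num, show (40 : ℝ) = 2 ^ 3 * 5 by norm_num,
    Real.log_mul (by norm_num) (by norm_num), Real.log_pow] at h
  norm_num at h
  obtain ⟨h3, h3'⟩ := log_five_bounds
  constructor <;> linarith [h.1, h.2, Real.log_two_gt_d9, Real.log_two_lt_d9]

lemma log_div_four {m : ℝ} (hm : 0 < m) : Real.log (m / 4) = Real.log m - 2 * Real.log 2 := by
  rw [Real.log_div hm.ne' (by norm_num), show (4 : ℝ) = 2 ^ 2 by norm_num, Real.log_pow]
  norm_num

/-! ### The sequence whose Poisson expectation governs the loss -/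

lemma braessSauerSeq_zero : braessSauerSeq 0 = -1 / 2 := by
  norm_num [braessSauerSeq, braessSauerConst]

lemma braessSauerSeq_one : braessSauerSeq 1 = -Real.log 2 - 1 := by
  have h : Real.log (1 / 2) = -Real.log 2 := by rw [one_div, Real.log_inv]
  norm_num [braessSauerSeq, braessSauerConst, h]

lemma braessSauerSeq_two : braessSauerSeq 2 = 2 * Real.log 2 - 3 / 4 := by
  norm_num [braessSauerSeq, braessSauerConst]

lemma braessSauerSeq_of_three_le {k : ℕ} (hk : 3 ≤ k) :
    braessSauerSeq k = k * Real.log (k - 1 / 4) - 3 / 4 := by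
  obtain ⟨m, rfl⟩ := Nat.exists_eq_add_of_le' hk
  simp only [braessSauerSeq, braessSauerConst, show m + 3 - 1 = m + 2 by omega,
    show m + 3 = (m + 1) + 2 by omega]
  push_cast
  ring_nf

lemma braessSauerSeq_bounds_of_log {k : ℕ} (hk : 3 ≤ k) {m l u : ℝ} (hm : m = 4 * k - 1)
    (h : l ≤ Real.log m ∧ Real.log m ≤ u) :
    k * (l - 2 * 0.6931471808) - 3 / 4 ≤ braessSauerSeq k ∧
    braessSauerSeq k ≤ k * (u - 2 * 0.6931471803) - 3 / 4 := by
  have hk' : (3 : ℝ) ≤ k := by exact_mod_cast hk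
  have e : (k : ℝ) - 1 / 4 = m / 4 := by rw [hm]; ring
  rw [braessSauerSeq_of_three_le hk, e, log_div_four (by linarith)]
  have h1 := Real.log_two_gt_d9
  have h2 := Real.log_two_lt_d9
  constructor
  · nlinarith [h.1]
  · nlinarith [h.2]

lemma braessSauerSeq_values :
    (-0.5 ≤ braessSauerSeq 0 ∧ braessSauerSeq 0 ≤ -0.5) ∧
    (-1.69315 ≤ braessSauerSeq 1 ∧ braessSauerSeq 1 ≤ -1.69314) ∧
    (0.63629 ≤ braessSauerSeq 2 ∧ braessSauerSeq 2 ≤ 0.6363) ∧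
    (2.28479 ≤ braessSauerSeq 3 ∧ braessSauerSeq 3 ≤ 2.28481) ∧
    (4.53702 ≤ braessSauerSeq 4 ∧ braessSauerSeq 4 ≤ 4.53703) ∧
    (7.04071 ≤ braessSauerSeq 5 ∧ braessSauerSeq 5 ≤ 7.04073) ∧
    (9.74519 ≤ braessSauerSeq 6 ∧ braessSauerSeq 6 ≤ 9.74521) ∧
    (12.61678 ≤ braessSauerSeq 7 ∧ braessSauerSeq 7 ≤ 12.61681) ∧
    (15.63152 ≤ braessSauerSeq 8 ∧ braessSauerSeq 8 ≤ 15.63156) ∧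
    (18.77146 ≤ braessSauerSeq 9 ∧ braessSauerSeq 9 ≤ 18.7715) ∧
    (22.02264 ≤ braessSauerSeq 10 ∧ braessSauerSeq 10 ≤ 22.0227) := by
  have h1 := Real.log_two_gt_d9
  have h2 := Real.log_two_lt_d9
  obtain ⟨l3, u3⟩ := log_three_bounds
  obtain ⟨l5, u5⟩ := log_five_bounds
  have e15 : Real.log 15 = Real.log 3 + Real.log 5 := by
    rw [← Real.log_mul (by norm_num) (by norm_num)]; norm_num
  have e27 : Real.log 27 = 3 * Real.log 3 := by
    rw [show (27 : ℝ) = 3 ^ 3 by norm_num, Real.log_pow]; norm_num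
  have b3 := braessSauerSeq_bounds_of_log (k := 3) (by norm_num) (by norm_num) log_eleven_bounds
  have b4 := braessSauerSeq_bounds_of_log (k := 4) (m := 15) (l := 2.7080498) (u := 2.7080507)
    (by norm_num) (by norm_num) (by rw [e15]; constructor <;> linarith)
  have b5 := braessSauerSeq_bounds_of_log (k := 5) (by norm_num) (by norm_num) log_nineteen_bounds
  have b6 := braessSauerSeq_bounds_of_log (k := 6) (by norm_num) (by norm_num)
    log_twentythree_bounds
  have b7 := braessSauerSeq_bounds_of_log (k := 7) (m := 27) (l := 3.2958366) (u := 3.2958375)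
    (by norm_num) (by norm_num) (by rw [e27]; constructor <;> linarith)
  have b8 := braessSauerSeq_bounds_of_log (k := 8) (by norm_num) (by norm_num)
    log_thirtyone_bounds
  have b9 := braessSauerSeq_bounds_of_log (k := 9) (by norm_num) (by norm_num)
    log_thirtyfive_bounds
  have b10 := braessSauerSeq_bounds_of_log (k := 10) (by norm_num) (by norm_num)
    log_thirtynine_bounds
  rw [braessSauerSeq_zero, braessSauerSeq_one, braessSauerSeq_two]
  norm_num at b3 b4 b5 b6 b7 b8 b9 b10 ⊢
  refine ⟨⟨?_, ?_⟩, ⟨?_, ?_⟩, ⟨?_, ?_⟩, ⟨?_, ?_⟩, ⟨?_, ?_⟩, ⟨?_, ?_⟩, ⟨?_, ?_⟩, ⟨?_, ?_⟩,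
    ⟨?_, ?_⟩, ?_, ?_⟩ <;> linarith

/-- `log z ≥ 1 - 1 / z`, used around the point `11`. -/
lemma log_eleven_add_le_log {y : ℝ} (hy : 0 < y) : Real.log 11 + 1 - 11 / y ≤ Real.log y := by
  have h := Real.one_sub_inv_le_log_of_pos (x := y / 11) (by positivity)
  rw [Real.log_div hy.ne' (by norm_num), inv_div] at h
  linarith

/-- With `log y ≥ log 11 + 1 - 11 / y` the slope is `log 11 + 1`. The intercept is `-11 · 40/39 -
3/4` rounded down, the ratio `k / (k - 1/4)` being largest at `k = 10`. -/
lemma affine_le_braessSauerSeq {k : ℕ} (hk : 10 ≤ k) :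
    -12.0321 + 3.39789 * (k : ℝ) ≤ braessSauerSeq k := by
  have hk' : (10 : ℝ) ≤ k := by exact_mod_cast hk
  rw [braessSauerSeq_of_three_le (by omega)]
  have h := mul_le_mul_of_nonneg_left (log_eleven_add_le_log (y := (k : ℝ) - 1 / 4) (by linarith))
    (by linarith : (0 : ℝ) ≤ k)
  have h2 : (k : ℝ) * (11 / (k - 1 / 4)) ≤ 11 + 11 / 39 := by
    have h0 : (0 : ℝ) < k - 1 / 4 := by linarith
    rw [← mul_div_assoc, div_le_iff₀ h0]
    linarith
  have h3 := mul_le_mul_of_nonneg_left log_eleven_bounds.1 (by linarith : (0 : ℝ) ≤ k)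
  nlinarith

lemma braessSauerSeq_diff_eq {k : ℕ} (hk : 3 ≤ k) :
    braessSauerSeq (k + 1) - braessSauerSeq k
      = Real.log (k + 3 / 4) + k * (Real.log (k + 3 / 4) - Real.log (k - 1 / 4)) := by
  rw [braessSauerSeq_of_three_le hk, braessSauerSeq_of_three_le (by omega)]
  push_cast
  rw [show (k : ℝ) + 1 - 1 / 4 = k + 3 / 4 by ring]
  ring

lemma le_braessSauerSeq_diff {k : ℕ} (hk : 10 ≤ k) :
    3.304 ≤ braessSauerSeq (k + 1) - braessSauerSeq k := by
  have hk' : (10 : ℝ) ≤ k := by exact_mod_cast hk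
  rw [braessSauerSeq_diff_eq (by omega)]
  have h1 := log_eleven_add_le_log (y := (k : ℝ) + 3 / 4) (by linarith)
  have h2 : 11 / ((k : ℝ) + 3 / 4) ≤ 44 / 43 := by
    rw [div_le_div_iff₀ (by linarith) (by norm_num)]; linarith
  have h3 := Real.one_sub_inv_le_log_of_pos (x := ((k : ℝ) + 3 / 4) / (k - 1 / 4))
    (div_pos (by linarith) (by linarith))
  rw [Real.log_div (by linarith) (by linarith), inv_div] at h3
  have h4 := mul_le_mul_of_nonneg_left h3 (by linarith : (0 : ℝ) ≤ k)
  have h5 : 40 / 43 ≤ (k : ℝ) * (1 - (k - 1 / 4) / (k + 3 / 4)) := by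
    have : (k : ℝ) * (1 - (k - 1 / 4) / (k + 3 / 4)) = k / (k + 3 / 4) := by
      have : (k : ℝ) + 3 / 4 ≠ 0 := by linarith
      field_simp; ring
    rw [this, div_le_div_iff₀ (by norm_num) (by linarith)]
    linarith
  have := log_eleven_bounds.1
  linarith

lemma braessSauerSeq_diff_le {k : ℕ} (hk : 10 ≤ k) :
    braessSauerSeq (k + 1) - braessSauerSeq k ≤ 2.492 + 1 / 11 * (k : ℝ) := by
  have hk' : (10 : ℝ) ≤ k := by exact_mod_cast hk
  rw [braessSauerSeq_diff_eq (by omega)]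
  have h1 := Real.log_le_sub_one_of_pos (x := ((k : ℝ) + 3 / 4) / 11) (by linarith)
  rw [Real.log_div (by linarith) (by norm_num)] at h1
  have h3 := Real.log_le_sub_one_of_pos (x := ((k : ℝ) + 3 / 4) / (k - 1 / 4))
    (div_pos (by linarith) (by linarith))
  rw [Real.log_div (by linarith) (by linarith)] at h3
  have h4 := mul_le_mul_of_nonneg_left h3 (by linarith : (0 : ℝ) ≤ k)
  have h5 : (k : ℝ) * ((k + 3 / 4) / (k - 1 / 4) - 1) ≤ 40 / 39 := by
    have h0 : (k : ℝ) - 1 / 4 ≠ 0 := by linarith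
    have : (k : ℝ) * ((k + 3 / 4) / (k - 1 / 4) - 1) = k / (k - 1 / 4) := by
      rw [div_sub_one h0, ← mul_div_assoc]
      congr 1
      ring
    rw [this, div_le_div_iff₀ (by linarith) (by norm_num)]
    linarith
  have := log_eleven_bounds.2
  linarith

/-- The sequence whose Poisson expectation is `x` times the second derivative of the gap. -/
noncomputable def braessSauerCurv (k : ℕ) : ℝ :=
  k * (braessSauerSeq (k - 1 + 1 + 1) - braessSauerSeq (k - 1 + 1)
    - (braessSauerSeq (k - 1 + 1) - braessSauerSeq (k - 1))) - 1

/-- The remainder bound of the inverse hyperbolic tangent series with no terms kept, at `(z - 1) /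
(z + 1)`. -/
lemma log_le_half_sub_inv {z : ℝ} (hz : 1 ≤ z) : Real.log z ≤ (z - 1 / z) / 2 := by
  have hz0 : 0 < z := by linarith
  have h := Real.log_div_le_sum_range_add (x := (z - 1) / (z + 1))
    (div_nonneg (by linarith) (by linarith)) (by rw [div_lt_one (by linarith)]; linarith) 0
  have e : (1 + (z - 1) / (z + 1)) / (1 - (z - 1) / (z + 1)) = z := by
    have : z + 1 ≠ 0 := by linarith
    field_simp; ring
  rw [e] at h
  have e2 : (z - 1) / (z + 1) / (1 - ((z - 1) / (z + 1)) ^ 2) = (z - 1 / z) / 4 := by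
    have h1 : z + 1 ≠ 0 := by linarith
    have h2 : (1 - ((z - 1) / (z + 1)) ^ 2) = 4 * z / (z + 1) ^ 2 := by field_simp; ring
    rw [h2]
    field_simp
    ring
  norm_num at h
  norm_num at e2
  rw [e2] at h
  norm_num
  linarith

lemma curv_rational_bound {s : ℝ} (hs : 15 / 4 ≤ s) :
    1 / (s + 1 / 4) ≤ 2 * (1 / s + (1 / s) ^ 3 / 3)
      - (s + 1 / 4) * ((2 * s ^ 2 - 1) / (2 * s ^ 2 * (s ^ 2 - 1))) := by
  have h0 : 0 < s := by linarith
  have h1 : 0 < s ^ 2 - 1 := by nlinarith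
  have h2 : 0 < s + 1 / 4 := by linarith
  rw [← sub_nonneg]
  have e : 2 * (1 / s + (1 / s) ^ 3 / 3)
      - (s + 1 / 4) * ((2 * s ^ 2 - 1) / (2 * s ^ 2 * (s ^ 2 - 1))) - 1 / (s + 1 / 4)
      = (10 * s ^ 3 - 8 * s ^ 2 - 61 * s - 16) / (96 * s ^ 3 * (s ^ 2 - 1) * (s + 1 / 4)) := by
    field_simp
    ring
  rw [e]
  refine div_nonneg ?_ (by positivity)
  nlinarith [mul_nonneg (sub_nonneg.2 hs) (sub_nonneg.2 hs), pow_pos h0 2]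

/-- From `k = 4` on, all three values involved follow the formula with `β = 3/4`. With `s = k - 1/4`
the second difference equals `log (s+1) - log (s-1)` minus `(s + 1/4) log (s² / (s² - 1))`. The
first part is bounded below by two series terms, the second above by `log_le_half_sub_inv`, leaving
`curv_rational_bound`. -/
lemma braessSauerCurv_nonneg {k : ℕ} (hk : 4 ≤ k) : 0 ≤ braessSauerCurv k := by
  obtain ⟨m, rfl⟩ := Nat.exists_eq_add_of_le' hk
  have hm : (0 : ℝ) ≤ m := m.cast_nonneg
  rw [braessSauerCurv, show m + 4 - 1 = m + 3 by omega, braessSauerSeq_of_three_le (by omega),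
    braessSauerSeq_of_three_le (by omega), braessSauerSeq_of_three_le (by omega)]
  push_cast
  set s : ℝ := m + 15 / 4 with hs
  rw [show (m : ℝ) + 3 + 1 + 1 - 1 / 4 = s + 1 by rw [hs]; ring,
    show (m : ℝ) + 3 + 1 - 1 / 4 = s by rw [hs]; ring,
    show (m : ℝ) + 3 - 1 / 4 = s - 1 by rw [hs]; ring,
    show (m : ℝ) + 3 + 1 + 1 = s + 5 / 4 by rw [hs]; ring,
    show (m : ℝ) + 3 + 1 = s + 1 / 4 by rw [hs]; ring,
    show (m : ℝ) + 4 = s + 1 / 4 by rw [hs]; ring,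
    show (m : ℝ) + 3 = s - 3 / 4 by rw [hs]; ring]
  have hs1 : 15 / 4 ≤ s := by linarith
  have hs0 : 0 < s := by linarith
  have h1 := curv_rational_bound hs1
  have h2 := (log_ratio_bounds (y := 1 / s) (by positivity)
    (by rw [div_lt_one hs0]; linarith)).1
  have e1 : 1 + 1 / s = (s + 1) / s := by field_simp
  have e2 : 1 - 1 / s = (s - 1) / s := by field_simp
  rw [e1, e2, Real.log_div (by linarith) hs0.ne', Real.log_div (by linarith) hs0.ne'] at h2
  have h2' : 0 ≤ (1 / s) ^ 5 / 5 := by positivity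
  have hss : 0 < s ^ 2 - 1 := by nlinarith
  have h3 := log_le_half_sub_inv (z := s ^ 2 / (s ^ 2 - 1)) (by rw [le_div_iff₀ hss]; linarith)
  rw [Real.log_div (by positivity) hss.ne', Real.log_pow,
    show s ^ 2 - 1 = (s + 1) * (s - 1) by ring, Real.log_mul (by linarith) (by linarith),
    show (s + 1) * (s - 1) = s ^ 2 - 1 by ring] at h3
  have e3 : (s ^ 2 / (s ^ 2 - 1) - 1 / (s ^ 2 / (s ^ 2 - 1))) / 2
      = (2 * s ^ 2 - 1) / (2 * s ^ 2 * (s ^ 2 - 1)) := by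
    field_simp; ring
  rw [e3] at h3
  push_cast at h3
  have h4 := mul_le_mul_of_nonneg_left h3 (by linarith : 0 ≤ s + 1 / 4)
  have h5 : 1 / (s + 1 / 4) ≤ (s + 5 / 4) * Real.log (s + 1) - 3 / 4
      - ((s + 1 / 4) * Real.log s - 3 / 4)
      - ((s + 1 / 4) * Real.log s - 3 / 4 - ((s - 3 / 4) * Real.log (s - 1) - 3 / 4)) := by
    linarith
  have h6 := mul_le_mul_of_nonneg_left h5 (by linarith : 0 ≤ s + 1 / 4)
  rw [mul_one_div_cancel (by linarith)] at h6
  linarith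

lemma braessSauerCurv_values : braessSauerCurv 0 = -1 ∧ 2.52 ≤ braessSauerCurv 1 ∧
    -2.364 ≤ braessSauerCurv 2 ∧ 0.81 ≤ braessSauerCurv 3 := by
  obtain ⟨h0, h1, h2, h3, h4, -⟩ := braessSauerSeq_values
  refine ⟨by simp [braessSauerCurv], ?_, ?_, ?_⟩ <;> norm_num [braessSauerCurv] <;>
    norm_num at h0 h1 h2 h3 h4 <;> linarith [h0.1, h0.2, h1.1, h1.2, h2.1, h2.2, h3.1, h3.2]

/-! ### The Poisson gap is nonnegative -/

/-- The first derivative of `poissonGap`. -/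
noncomputable def poissonGapDeriv (x : ℝ) : ℝ :=
  poissonExp x (fun k => braessSauerSeq (k + 1) - braessSauerSeq k) - Real.log x - 1

/-- The second derivative of `poissonGap`. -/
noncomputable def poissonGapDeriv2 (x : ℝ) : ℝ :=
  poissonExp x (fun k => braessSauerSeq (k + 1 + 1) - braessSauerSeq (k + 1)
    - (braessSauerSeq (k + 1) - braessSauerSeq k)) - 1 / x

lemma expGrowth_braessSauerSeq_diff :
    ExpGrowth fun k => braessSauerSeq (k + 1) - braessSauerSeq k :=
  expGrowth_braessSauerSeq.shift.sub expGrowth_braessSauerSeq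

lemma expGrowth_braessSauerSeq_diff2 :
    ExpGrowth fun k => braessSauerSeq (k + 1 + 1) - braessSauerSeq (k + 1)
      - (braessSauerSeq (k + 1) - braessSauerSeq k) :=
  expGrowth_braessSauerSeq_diff.shift.sub expGrowth_braessSauerSeq_diff

lemma expGrowth_braessSauerCurv : ExpGrowth braessSauerCurv :=
  (ExpGrowth.natCast.mul expGrowth_braessSauerSeq_diff2.shift_back).sub (ExpGrowth.const 1)

lemma hasDerivAt_poissonGap {x : ℝ} (hx : 0 < x) :
    HasDerivAt poissonGap (poissonGapDeriv x) x := by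
  have h := ((hasDerivAt_poissonExp expGrowth_braessSauerSeq x).sub
    (Real.hasDerivAt_mul_log hx.ne')).add_const (1 / 2)
  refine h.congr_deriv ?_
  rw [poissonGapDeriv]; ring

lemma hasDerivAt_poissonGapDeriv {x : ℝ} (hx : 0 < x) :
    HasDerivAt poissonGapDeriv (poissonGapDeriv2 x) x := by
  have h := ((hasDerivAt_poissonExp expGrowth_braessSauerSeq_diff x).sub
    (Real.hasDerivAt_log hx.ne')).sub_const 1
  refine h.congr_deriv ?_
  rw [poissonGapDeriv2, one_div]

lemma mul_poissonGapDeriv2 {x : ℝ} (hx : 0 < x) :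
    x * poissonGapDeriv2 x = poissonExp x braessSauerCurv := by
  have h := poissonExp_sub (x := x)
    (ExpGrowth.natCast.mul expGrowth_braessSauerSeq_diff2.shift_back) (ExpGrowth.const 1)
  rw [poissonExp_natCast_mul expGrowth_braessSauerSeq_diff2, poissonExp_const] at h
  have h2 : poissonExp x braessSauerCurv = _ := h
  rw [h2, poissonGapDeriv2, mul_sub, mul_one_div_cancel hx.ne']

/-- The terms of index at least 4 are dropped, and the other four are divided by their factorials.
The cubic is nonnegative on `[0.53, 2.4]` and on `[5.8, ∞)`, whence the cutting points below. -/
lemma cubic_le_mul_poissonGapDeriv2 {x : ℝ} (hx : 0 < x) :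
    Real.exp (-x) * (-1 + 2.52 * x - 1.182 * x ^ 2 + 0.135 * x ^ 3) ≤ x * poissonGapDeriv2 x := by
  rw [mul_poissonGapDeriv2 hx]
  have h := le_poissonExp_of_affine_le hx.le expGrowth_braessSauerCurv (c := 0) (s := 0) (K := 4)
    fun k hk => by simpa using braessSauerCurv_nonneg hk
  refine le_trans ?_ h
  obtain ⟨w0, w1, w2, w3⟩ := braessSauerCurv_values
  norm_num [Finset.sum_range_succ, Nat.factorial, w0]
  have a1 := mul_le_mul_of_nonneg_right w1 hx.le
  have a2 := mul_le_mul_of_nonneg_right w2 (sq_nonneg x)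
  have a3 := mul_le_mul_of_nonneg_right w3 (pow_pos hx 3).le
  norm_num at a1 a2 a3
  refine mul_le_mul_of_nonneg_left ?_ (Real.exp_pos _).le
  linarith

/-- A function with nonnegative second derivative lies above its tangents. -/
lemma tangent_le_of_deriv2_nonneg {D : Set ℝ} (hD : Convex ℝ D) {f f' f'' : ℝ → ℝ}
    (hf : ∀ x ∈ D, HasDerivAt f (f' x) x) (hf' : ∀ x ∈ D, HasDerivAt f' (f'' x) x)
    (hf'' : ∀ x ∈ D, 0 ≤ f'' x) {x y : ℝ} (hx : x ∈ D) (hy : y ∈ D) :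
    f y + f' y * (x - y) ≤ f x := by
  have hconv : ConvexOn ℝ D f := convexOn_of_hasDerivWithinAt2_nonneg hD
    (fun z hz => (hf z hz).continuousAt.continuousWithinAt)
    (fun z hz => (hf z (interior_subset hz)).hasDerivWithinAt)
    (fun z hz => (hf' z (interior_subset hz)).hasDerivWithinAt)
    (fun z hz => hf'' z (interior_subset hz))
  rcases lt_trichotomy x y with h | h | h
  · have := hconv.slope_le_of_hasDerivAt hx hy h (hf y hy)
    rw [slope_def_field, div_le_iff₀ (by linarith)] at this
    linarith
  · simp [h]
  · have := hconv.le_slope_of_hasDerivAt hy hx h (hf y hy)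
    rw [slope_def_field, le_div_iff₀ (by linarith)] at this
    linarith

/-! ### Values of the gap and of its slope at 2 and 4 -/

lemma exp_neg_two_bounds :
    0.1353352 ≤ Real.exp (-2) ∧ Real.exp (-2) ≤ 0.1353353 := by
  have h1 := Real.exp_one_gt_d9
  have h2 := Real.exp_one_lt_d9
  have e : Real.exp (-2) = (Real.exp 1 ^ 2)⁻¹ := by
    rw [Real.exp_neg, ← Real.exp_nat_mul]; norm_num
  have l : (2.7182818283 : ℝ) ^ 2 ≤ Real.exp 1 ^ 2 := pow_le_pow_left₀ (by norm_num) h1.le 2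
  have u : Real.exp 1 ^ 2 ≤ (2.7182818286 : ℝ) ^ 2 :=
    pow_le_pow_left₀ (Real.exp_pos _).le h2.le 2
  rw [e]
  constructor
  · refine le_trans ?_ (inv_anti₀ (by positivity) u); norm_num
  · refine (inv_anti₀ (by positivity) l).trans ?_; norm_num

lemma exp_neg_four_bounds :
    0.01831561 ≤ Real.exp (-4) ∧ Real.exp (-4) ≤ 0.01831565 := by
  obtain ⟨h1, h2⟩ := exp_neg_two_bounds
  have e : Real.exp (-4) = Real.exp (-2) ^ 2 := by
    rw [← Real.exp_nat_mul]; norm_num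
  rw [e]
  constructor <;> nlinarith

/-- Ten terms are kept exactly and the tail is replaced by an affine minorant with known Poisson
expectation, so the evaluation at 2 and 4 is a finite computation. -/
lemma poissonExp_braessSauerSeq_lower {x : ℝ} (hx : 0 ≤ x) :
    -12.0321 + 3.39789 * x + Real.exp (-x) * ∑ k ∈ Finset.range 10,
      (braessSauerSeq k - (-12.0321 + 3.39789 * k)) * x ^ k / k.factorial
      ≤ poissonExp x braessSauerSeq :=
  le_poissonExp_of_affine_le hx expGrowth_braessSauerSeq fun _ hk => affine_le_braessSauerSeq hk

lemma poissonExp_diff_lower {x : ℝ} (hx : 0 ≤ x) :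
    3.304 + 0 * x + Real.exp (-x) * ∑ k ∈ Finset.range 10,
      (braessSauerSeq (k + 1) - braessSauerSeq k - (3.304 + 0 * (k : ℝ))) * x ^ k / k.factorial
      ≤ poissonExp x (fun k => braessSauerSeq (k + 1) - braessSauerSeq k) :=
  le_poissonExp_of_affine_le hx expGrowth_braessSauerSeq_diff fun _ hk => by
    simpa using le_braessSauerSeq_diff hk

lemma poissonExp_diff_upper {x : ℝ} (hx : 0 ≤ x) :
    poissonExp x (fun k => braessSauerSeq (k + 1) - braessSauerSeq k)
      ≤ 2.492 + 1 / 11 * x + Real.exp (-x) * ∑ k ∈ Finset.range 10,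
        (braessSauerSeq (k + 1) - braessSauerSeq k - (2.492 + 1 / 11 * (k : ℝ)))
          * x ^ k / k.factorial := by
  have h := le_poissonExp_of_affine_le hx (expGrowth_braessSauerSeq_diff.const_mul (-1))
    (c := -2.492) (s := -(1 / 11)) (K := 10) fun k hk => by
      have := braessSauerSeq_diff_le hk
      linarith
  rw [poissonExp_const_mul] at h
  have e : ∑ k ∈ Finset.range 10, (-1 * (braessSauerSeq (k + 1) - braessSauerSeq k)
      - (-2.492 + -(1 / 11) * (k : ℝ))) * x ^ k / k.factorial
      = -∑ k ∈ Finset.range 10,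
        (braessSauerSeq (k + 1) - braessSauerSeq k - (2.492 + 1 / 11 * (k : ℝ)))
          * x ^ k / k.factorial := by
    rw [← Finset.sum_neg_distrib]
    exact Finset.sum_congr rfl fun k _ => by ring
  rw [e] at h
  linarith

lemma poissonGap_two : 0.014 ≤ poissonGap 2 := by
  have h := poissonExp_braessSauerSeq_lower (x := 2) (by norm_num)
  obtain ⟨b0, b1, b2, b3, b4, b5, b6, b7, b8, b9, -⟩ := braessSauerSeq_values
  have hS : 45.345 ≤ ∑ k ∈ Finset.range 10,
      (braessSauerSeq k - (-12.0321 + 3.39789 * k)) * (2 : ℝ) ^ k / k.factorial := by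
    norm_num [Finset.sum_range_succ, Nat.factorial] at b0 b1 b2 b3 b4 b5 b6 b7 b8 b9 ⊢
    linarith only [b0.1, b1.1, b2.1, b3.1, b4.1, b5.1, b6.1, b7.1, b8.1, b9.1]
  have hE := exp_neg_two_bounds.1
  have hl := Real.log_two_lt_d9
  have h2 := mul_le_mul hE hS (by norm_num) (Real.exp_pos _).le
  rw [poissonGap]
  norm_num at h2 ⊢
  linarith

lemma poissonGap_four : 0.0205 ≤ poissonGap 4 := by
  have h := poissonExp_braessSauerSeq_lower (x := 4) (by norm_num)
  obtain ⟨b0, b1, b2, b3, b4, b5, b6, b7, b8, b9, -⟩ := braessSauerSeq_values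
  have hS : 191.452 ≤ ∑ k ∈ Finset.range 10,
      (braessSauerSeq k - (-12.0321 + 3.39789 * k)) * (4 : ℝ) ^ k / k.factorial := by
    norm_num [Finset.sum_range_succ, Nat.factorial] at b0 b1 b2 b3 b4 b5 b6 b7 b8 b9 ⊢
    linarith only [b0.1, b1.1, b2.1, b3.1, b4.1, b5.1, b6.1, b7.1, b8.1, b9.1]
  have hE := exp_neg_four_bounds.1
  have hl := Real.log_two_lt_d9
  have h2 := mul_le_mul hE hS (by norm_num) (Real.exp_pos _).le
  have h4 : Real.log 4 = 2 * Real.log 2 := by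
    rw [show (4 : ℝ) = 2 ^ 2 by norm_num, Real.log_pow]; norm_num
  rw [poissonGap]
  norm_num at h2 ⊢
  linarith

lemma poissonGapDeriv_two : -0.001 ≤ poissonGapDeriv 2 ∧ poissonGapDeriv 2 ≤ 0.001 := by
  have hl := poissonExp_diff_lower (x := 2) (by norm_num)
  have hu := poissonExp_diff_upper (x := 2) (by norm_num)
  obtain ⟨b0, b1, b2, b3, b4, b5, b6, b7, b8, b9, b10⟩ := braessSauerSeq_values
  obtain ⟨hE, hE'⟩ := exp_neg_two_bounds
  have hlog := Real.log_two_gt_d9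
  have hlog' := Real.log_two_lt_d9
  have hSl : -11.901 ≤ ∑ k ∈ Finset.range 10,
      (braessSauerSeq (k + 1) - braessSauerSeq k - (3.304 + 0 * (k : ℝ))) * (2 : ℝ) ^ k
        / k.factorial := by
    norm_num [Finset.sum_range_succ, Nat.factorial] at b0 b1 b2 b3 b4 b5 b6 b7 b8 b9 b10 ⊢
    linarith only [b0.2, b1.1, b1.2, b2.1, b2.2, b3.1, b3.2, b4.1, b4.2, b5.1, b5.2, b6.1, b6.2,
      b7.1, b7.2, b8.1, b8.2, b9.1, b9.2, b10.1]
  have hSu : ∑ k ∈ Finset.range 10,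
      (braessSauerSeq (k + 1) - braessSauerSeq k - (2.492 + 1 / 11 * (k : ℝ))) * (2 : ℝ) ^ k
        / k.factorial ≤ -7.242 := by
    norm_num [Finset.sum_range_succ, Nat.factorial] at b0 b1 b2 b3 b4 b5 b6 b7 b8 b9 b10 ⊢
    linarith only [b0.1, b1.1, b1.2, b2.1, b2.2, b3.1, b3.2, b4.1, b4.2, b5.1, b5.2, b6.1, b6.2,
      b7.1, b7.2, b8.1, b8.2, b9.1, b9.2, b10.2]
  have h1 := mul_le_mul_of_nonneg_left hSl (Real.exp_pos (-2)).le
  have h2 := mul_le_mul_of_nonneg_left hSu (Real.exp_pos (-2)).le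
  rw [poissonGapDeriv]
  constructor <;> linarith

lemma poissonGapDeriv_four : -0.0025 ≤ poissonGapDeriv 4 ∧ poissonGapDeriv 4 ≤ 0 := by
  have hl := poissonExp_diff_lower (x := 4) (by norm_num)
  have hu := poissonExp_diff_upper (x := 4) (by norm_num)
  obtain ⟨b0, b1, b2, b3, b4, b5, b6, b7, b8, b9, b10⟩ := braessSauerSeq_values
  obtain ⟨hE, hE'⟩ := exp_neg_four_bounds
  have hlog := Real.log_two_gt_d9
  have hlog' := Real.log_two_lt_d9
  have hSl : -50.22 ≤ ∑ k ∈ Finset.range 10,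
      (braessSauerSeq (k + 1) - braessSauerSeq k - (3.304 + 0 * (k : ℝ))) * (4 : ℝ) ^ k
        / k.factorial := by
    norm_num [Finset.sum_range_succ, Nat.factorial] at b0 b1 b2 b3 b4 b5 b6 b7 b8 b9 b10 ⊢
    linarith only [b0.2, b1.1, b1.2, b2.1, b2.2, b3.1, b3.2, b4.1, b4.2, b5.1, b5.2, b6.1, b6.2,
      b7.1, b7.2, b8.1, b8.2, b9.1, b9.2, b10.1]
  have hSu : ∑ k ∈ Finset.range 10,
      (braessSauerSeq (k + 1) - braessSauerSeq k - (2.492 + 1 / 11 * (k : ℝ))) * (4 : ℝ) ^ k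
        / k.factorial ≤ -25.67 := by
    norm_num [Finset.sum_range_succ, Nat.factorial] at b0 b1 b2 b3 b4 b5 b6 b7 b8 b9 b10 ⊢
    linarith only [b0.1, b1.1, b1.2, b2.1, b2.2, b3.1, b3.2, b4.1, b4.2, b5.1, b5.2, b6.1, b6.2,
      b7.1, b7.2, b8.1, b8.2, b9.1, b9.2, b10.2]
  have h1 := mul_le_mul_of_nonneg_left hSl (Real.exp_pos (-4)).le
  have h2 := mul_le_mul_of_nonneg_left hSu (Real.exp_pos (-4)).le
  have h4 : Real.log 4 = 2 * Real.log 2 := by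
    rw [show (4 : ℝ) = 2 ^ 2 by norm_num, Real.log_pow]; norm_num
  rw [poissonGapDeriv]
  constructor <;> linarith

lemma poissonGap_nonneg_of_le {x : ℝ} (hx : 0 < x) (hx' : x ≤ 0.53) : 0 ≤ poissonGap x := by
  obtain ⟨b0, b1, b2, b3, -⟩ := braessSauerSeq_values
  -- The line meets the sequence at 0 and passes just below `-log 2 - 1` at 1, so the corrections
  -- start in effect at `x^2`.
  have h := le_poissonExp_of_affine_le hx.le expGrowth_braessSauerSeq (c := -0.5) (s := -1.1932)
    (K := 4) fun k hk => by
      have hk' : (4 : ℝ) ≤ k := by exact_mod_cast hk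
      rw [braessSauerSeq_of_three_le (by omega)]
      have := Real.log_nonneg (x := (k : ℝ) - 1 / 4) (by linarith)
      nlinarith
  norm_num [Finset.sum_range_succ, Nat.factorial] at h b0 b1 b2 b3 hx'
  have hx2 := sq_nonneg x
  have hx3 := (pow_pos hx 3).le
  have hs : 1.76 * x ^ 2 + 1.06 * x ^ 3 ≤ braessSauerSeq 0 + 1 / 2
      + (braessSauerSeq 1 + 1 / 2 + 2983 / 2500) * x
      + (braessSauerSeq 2 + 1 / 2 + 2983 / 2500 * 2) * x ^ 2 / 2
      + (braessSauerSeq 3 + 1 / 2 + 2983 / 2500 * 3) * x ^ 3 / 6 := by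
    have t1 := mul_le_mul_of_nonneg_right b1.1 hx.le
    have t2 := mul_le_mul_of_nonneg_right b2.1 hx2
    have t3 := mul_le_mul_of_nonneg_right b3.1 hx3
    linarith [b0.1]
  have hpos : 0 ≤ 1.76 * x ^ 2 + 1.06 * x ^ 3 := by positivity
  have he := Real.one_sub_le_exp_neg x
  have h2 := mul_le_mul he hs hpos (Real.exp_pos _).le
  -- Tangent of the logarithm at `1/2`, close to the right end of the interval.
  have hlog : Real.log x ≤ 2 * x - 1 - Real.log 2 := by
    have := Real.log_le_sub_one_of_pos (x := x * 2) (by positivity)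
    rw [Real.log_mul hx.ne' (by norm_num)] at this
    linarith
  have h3 := mul_le_mul_of_nonneg_left hlog hx.le
  have h4 := mul_le_mul_of_nonneg_left Real.log_two_gt_d9.le hx.le
  have h5 : 0 ≤ x * (0.4999 - 2 * x + (1 - x) * (1.76 * x + 1.06 * x ^ 2)) := by
    refine mul_nonneg hx.le ?_
    nlinarith [mul_nonneg hx.le (sub_nonneg.2 hx'), mul_nonneg hx2 (sub_nonneg.2 hx')]
  rw [poissonGap]
  norm_num at h h2 h3 h4 h5 ⊢
  nlinarith

/-- The gap is convex here and almost flat at 2: its slope is at most `0.001` in absolute value, and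
the tangent stays positive because the gap at 2 is at least `0.014`. -/
lemma poissonGap_nonneg_of_mem_left {x : ℝ} (hx : x ∈ Set.Icc (0.53 : ℝ) 2.4) :
    0 ≤ poissonGap x := by
  have hpos : ∀ z ∈ Set.Icc (0.53 : ℝ) 2.4, 0 < z := fun z hz => by
    have := hz.1; norm_num at this; linarith
  have h := tangent_le_of_deriv2_nonneg (convex_Icc (0.53 : ℝ) 2.4)
    (fun z hz => hasDerivAt_poissonGap (hpos z hz))
    (fun z hz => hasDerivAt_poissonGapDeriv (hpos z hz))
    (fun z hz => by
      refine nonneg_of_mul_nonneg_right (le_trans (mul_nonneg (Real.exp_pos _).le ?_)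
        (cubic_le_mul_poissonGapDeriv2 (hpos z hz))) (hpos z hz)
      obtain ⟨h1, h2⟩ := hz
      norm_num at h1 h2 ⊢
      nlinarith [mul_nonneg (sub_nonneg.2 h1) (sub_nonneg.2 h2),
        mul_nonneg (mul_nonneg (sub_nonneg.2 h1) (sub_nonneg.2 h2)) (sub_nonneg.2 h2)])
    hx (y := 2) (by constructor <;> norm_num)
  have h1 := poissonGap_two
  obtain ⟨h2, h3⟩ := poissonGapDeriv_two
  obtain ⟨h4, h5⟩ := hx
  norm_num at h1 h2 h3 h4 h5
  nlinarith

/-- Tangent of the exponential at `7/2`, with `exp (7/2)` rounded down to 33. -/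
lemma exp_lower_tangent (x : ℝ) : 33 * (x - 2.5) ≤ Real.exp x := by
  have h1 : (33 : ℝ) ≤ Real.exp (7 / 2) := by
    have h := Real.exp_one_gt_d9
    have e : Real.exp (7 / 2) ^ 2 = Real.exp 1 ^ 7 := by
      rw [← Real.exp_nat_mul, ← Real.exp_nat_mul]; norm_num
    have l : (2.7182818283 : ℝ) ^ 7 ≤ Real.exp 1 ^ 7 := pow_le_pow_left₀ (by norm_num) h.le 7
    refine le_of_sq_le_sq ?_ (Real.exp_pos _).le
    rw [e]
    refine le_trans ?_ l
    norm_num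
  have h2 := Real.add_one_le_exp (x - 7 / 2)
  have e : Real.exp x = Real.exp (7 / 2) * Real.exp (x - 7 / 2) := by
    rw [← Real.exp_add]; ring_nf
  rcases le_total x 2.5 with h | h
  · have := Real.exp_pos x
    linarith
  · rw [e]
    refine mul_le_mul h1 ?_ (by linarith) (Real.exp_pos _).le
    norm_num at h2 ⊢
    linarith

lemma log_le_of_le_one {z : ℝ} (hz : 0 < z) (hz1 : z ≤ 1) :
    Real.log z ≤ 2 * (z - 1) / (z + 1) := by
  have h := Real.sum_range_le_log_div (x := (1 - z) / (1 + z))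
    (div_nonneg (by linarith) (by linarith)) (by rw [div_lt_one (by linarith)]; linarith) 1
  have e : (1 + (1 - z) / (1 + z)) / (1 - (1 - z) / (1 + z)) = z⁻¹ := by
    have h0 : 1 + z ≠ 0 := by linarith
    have h1 : 1 + (1 - z) / (1 + z) = 2 / (1 + z) := by field_simp; ring
    have h2 : 1 - (1 - z) / (1 + z) = z * (2 / (1 + z)) := by field_simp; ring
    rw [h1, h2]
    field_simp
  rw [e, Real.log_inv] at h
  norm_num at h
  have e2 : 2 * (z - 1) / (z + 1) = -2 * ((1 - z) / (1 + z)) := by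
    rw [add_comm z 1]; ring
  rw [e2]
  linarith

lemma poissonGap_nonneg_of_mem_right {x : ℝ} (hx : x ∈ Set.Icc (2.4 : ℝ) 5.8) :
    0 ≤ poissonGap x := by
  have hpos : ∀ z ∈ Set.Icc (2.4 : ℝ) 5.8, 0 < z := fun z hz => by
    have := hz.1; norm_num at this; linarith
  -- The cubic is not nonnegative on all of this interval. Adding `0.03 x log x` contributes `0.03`
  -- to `x` times the second derivative, and `exp_lower_tangent` shows that this restores convexity.
  have h := tangent_le_of_deriv2_nonneg (convex_Icc (2.4 : ℝ) 5.8)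
    (f := fun z => poissonGap z + 0.03 * (z * Real.log z))
    (f' := fun z => poissonGapDeriv z + 0.03 * (Real.log z + 1))
    (f'' := fun z => poissonGapDeriv2 z + 0.03 * z⁻¹)
    (fun z hz => (hasDerivAt_poissonGap (hpos z hz)).add
      ((Real.hasDerivAt_mul_log (hpos z hz).ne').const_mul _))
    (fun z hz => (hasDerivAt_poissonGapDeriv (hpos z hz)).add
      (((Real.hasDerivAt_log (hpos z hz).ne').add_const 1).const_mul _))
    (fun z hz => by
      have hz0 := hpos z hz
      refine nonneg_of_mul_nonneg_right ?_ hz0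
      rw [mul_add, mul_left_comm, mul_inv_cancel₀ hz0.ne']
      have h1 := cubic_le_mul_poissonGapDeriv2 hz0
      have h2 := mul_le_mul_of_nonneg_left (exp_lower_tangent z) (Real.exp_pos (-z)).le
      rw [← Real.exp_add, neg_add_cancel, Real.exp_zero] at h2
      have h3 : 0 ≤ Real.exp (-z) * ((-1 + 2.52 * z - 1.182 * z ^ 2 + 0.135 * z ^ 3)
          + 0.03 * (33 * (z - 2.5))) := by
        refine mul_nonneg (Real.exp_pos _).le ?_
        obtain ⟨h4, h5⟩ := hz
        norm_num at h4 h5 ⊢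
        nlinarith [mul_nonneg (sub_nonneg.2 h4) (sq_nonneg (z - 3.7)),
          mul_nonneg (sub_nonneg.2 h4) (sq_nonneg (z - 4))]
      linarith)
    hx (y := 4) (by constructor <;> norm_num)
  have h1 := poissonGap_four
  obtain ⟨h2, h3⟩ := poissonGapDeriv_four
  obtain ⟨h4, h5⟩ := hx
  have hx0 : 0 < x := by norm_num at h4; linarith
  have hdiv : Real.log (x / 4) = Real.log x - Real.log 4 := Real.log_div hx0.ne' (by norm_num)
  norm_num at h h1 h2 h3 h4 h5
  -- The price of the added function is `0.03 (x log (x/4) - (x - 4))`. The bracket is at most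
  -- `(x-4)²/(x+4)` on the left and `(x-4)²/8` on the right; these equal `0.4` at `2.4` and `0.405`
  -- at `5.8`.
  rcases le_total x 4 with hx4 | hx4
  · have hlog : x * (Real.log x - Real.log 4) ≤ x - 4 + 0.4 := by
      have hl := log_le_of_le_one (z := x / 4) (by positivity) (by linarith)
      rw [hdiv] at hl
      have := mul_le_mul_of_nonneg_left hl hx0.le
      refine this.trans ?_
      have e : x * (2 * (x / 4 - 1) / (x / 4 + 1)) = 2 * x * (x - 4) / (x + 4) := by
        field_simp
      rw [e, div_le_iff₀ (by linarith)]
      norm_num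
      nlinarith
    norm_num at hlog
    nlinarith
  · have hlog : x * (Real.log x - Real.log 4) ≤ x - 4 + 0.405 := by
      have hl := log_le_half_sub_inv (z := x / 4) (by linarith)
      rw [hdiv] at hl
      have := mul_le_mul_of_nonneg_left hl hx0.le
      refine this.trans ?_
      have e : x * ((x / 4 - 1 / (x / 4)) / 2) = x ^ 2 / 8 - 2 := by
        field_simp
        ring
      rw [e]
      norm_num
      nlinarith
    norm_num at hlog
    nlinarith

lemma tendsto_neg_error_atTop :
    Tendsto (fun z : ℝ => -((200 + 200 * Real.log (2 * z)) / z)) atTop (nhds 0) := by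
  have h1 : Tendsto (fun z : ℝ => Real.log z / z) atTop (nhds 0) := by
    simpa using Real.tendsto_pow_log_div_mul_add_atTop 1 0 1 one_ne_zero
  have h2 : Tendsto (fun z : ℝ => (200 + 200 * Real.log 2) / z) atTop (nhds 0) :=
    tendsto_const_nhds.div_atTop tendsto_id
  have h3 := (h2.add (h1.const_mul 200)).neg
  rw [mul_zero, add_zero, neg_zero] at h3
  refine h3.congr' ?_
  filter_upwards [eventually_gt_atTop 0] with z hz
  rw [Real.log_mul (by norm_num) hz.ne']
  ring

/-- On this half-line the gap is convex and bounded above, hence nonincreasing; its lower bound from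
`neg_le_poissonGap` tends to 0, so it cannot be negative. -/
lemma poissonGap_nonneg_of_ge {x : ℝ} (hx : 5.8 ≤ x) : 0 ≤ poissonGap x := by
  have h58 : (0 : ℝ) < 5.8 := by norm_num
  have htan : ∀ y z : ℝ, 5.8 ≤ y → 5.8 ≤ z →
      poissonGap y + poissonGapDeriv y * (z - y) ≤ poissonGap z := fun y z hy hz =>
    tangent_le_of_deriv2_nonneg (convex_Ici (5.8 : ℝ))
      (fun t ht => hasDerivAt_poissonGap (h58.trans_le ht))
      (fun t ht => hasDerivAt_poissonGapDeriv (h58.trans_le ht))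
      (fun t ht => by
        refine nonneg_of_mul_nonneg_right (le_trans (mul_nonneg (Real.exp_pos _).le ?_)
          (cubic_le_mul_poissonGapDeriv2 (h58.trans_le ht))) (h58.trans_le ht)
        have ht' : (5.8 : ℝ) ≤ t := ht
        norm_num at ht' ⊢
        nlinarith [mul_nonneg (sub_nonneg.2 ht') (sub_nonneg.2 ht'),
          mul_nonneg (mul_nonneg (sub_nonneg.2 ht') (sub_nonneg.2 ht')) (sub_nonneg.2 ht')])
      hz hy
  have hder : ∀ y : ℝ, 5.8 ≤ y → poissonGapDeriv y ≤ 0 := by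
    intro y hy
    by_contra! hpos
    -- The point where a tangent of positive slope reaches height 2, above the bound `3/2`.
    set z : ℝ := y + (2 - poissonGap y) / poissonGapDeriv y with hz
    have hGy := poissonGap_le (h58.trans_le hy)
    have hyz : y ≤ z := by
      have : 0 ≤ (2 - poissonGap y) / poissonGapDeriv y := div_nonneg (by linarith) hpos.le
      linarith
    have h1 := htan y z hy (hy.trans hyz)
    have h2 : poissonGapDeriv y * (z - y) = 2 - poissonGap y := by
      rw [hz, add_sub_cancel_left, mul_div_cancel₀ _ hpos.ne']
    have h3 := poissonGap_le (h58.trans_le (hy.trans hyz))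
    linarith
  have hle : ∀ z : ℝ, x ≤ z → poissonGap z ≤ poissonGap x := by
    intro z hz
    have h1 := htan z x (hx.trans hz) hx
    have h2 := mul_nonneg_of_nonpos_of_nonpos (hder z (hx.trans hz)) (sub_nonpos.2 hz)
    linarith
  refine le_of_tendsto tendsto_neg_error_atTop ?_
  filter_upwards [eventually_ge_atTop x, eventually_ge_atTop 2] with z hz hz2
  exact (neg_le_poissonGap hz2).trans (hle z hz)

theorem poissonGap_nonneg {x : ℝ} (hx : 0 ≤ x) : 0 ≤ poissonGap x := by
  rcases hx.eq_or_lt with rfl | hx0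
  · rw [poissonGap, poissonExp, tsum_eq_single 0 (by intro k hk; simp [hk]), braessSauerSeq_zero]
    norm_num
  rcases le_total x 0.53 with h1 | h1
  · exact poissonGap_nonneg_of_le hx0 h1
  rcases le_total x 2.4 with h2 | h2
  · exact poissonGap_nonneg_of_mem_left ⟨h1, h2⟩
  rcases le_total x 5.8 with h3 | h3
  · exact poissonGap_nonneg_of_mem_right ⟨h2, h3⟩
  · exact poissonGap_nonneg_of_ge h3

/-! ### The loss of a letter, uniformly in its probability -/

lemma continuous_letterLoss (n : ℕ) : Continuous (letterLoss n) := by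
  unfold letterLoss binomialExp
  refine Continuous.add ?_ (Real.continuous_mul_log.comp (continuous_const.mul continuous_id))
  fun_prop

/-- Beyond `n p = M` the Taylor estimate applies. Below it, the Poisson limit gives `1/2 + η/2`, and
`p ≤ M / n ≤ η` makes `1/2` and `(1 - p) / 2` differ by at most `η/2`. -/
lemma eventually_forall_letterLoss_le {η : ℝ} (hη : 0 < η) :
    ∀ᶠ n : ℕ in atTop, ∀ p ∈ Set.Icc (0 : ℝ) 1, letterLoss n p - (1 - p) / 2 ≤ η := by
  have hlim : Tendsto (fun z : ℝ => (200 + 200 * Real.log (2 * z)) / z) atTop (nhds 0) := by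
    simpa using tendsto_neg_error_atTop.neg
  obtain ⟨M, hM⟩ := eventually_atTop.1
    ((hlim.eventually (ge_mem_nhds hη)).and (eventually_ge_atTop 2))
  have hM2 : 2 ≤ M := (hM M le_rfl).2
  filter_upwards [eventually_forall_letterLoss_lt (fun x hx => poissonGap_nonneg hx)
    (half_pos hη) M, eventually_ge_atTop 1, eventually_ge_atTop ⌈M / η⌉₊] with n h1 hn hn2 p hp
  have hn0 : (0 : ℝ) < n := by exact_mod_cast hn
  rcases le_total M (n * p) with h | h
  · have h2 := letterLoss_le_of_large hp.1 hp.2 (hM2.trans h)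
    have h3 := (hM _ h).1
    linarith
  · have h2 := h1 (n * p) ⟨mul_nonneg hn0.le hp.1, h⟩
    rw [mul_div_cancel_left₀ _ hn0.ne'] at h2
    have h3 : M / η ≤ n := (Nat.le_ceil _).trans (by exact_mod_cast hn2)
    have h4 : p ≤ η := by
      rw [div_le_iff₀ hη] at h3
      exact le_of_mul_le_mul_left (h.trans h3) hn0
    linarith

/-- The excess of the worst loss of a letter over its limiting value. -/
noncomputable def letterExcess (n : ℕ) : ℝ :=
  sSup ((fun p => letterLoss n p - (1 - p) / 2) '' Set.Icc (0 : ℝ) 1)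

lemma letterLoss_le_letterExcess {n : ℕ} {p : ℝ} (hp : p ∈ Set.Icc (0 : ℝ) 1) :
    letterLoss n p ≤ (1 - p) / 2 + letterExcess n := by
  have hb : BddAbove ((fun p => letterLoss n p - (1 - p) / 2) '' Set.Icc (0 : ℝ) 1) :=
    isCompact_Icc.bddAbove_image
      ((continuous_letterLoss n).sub (by fun_prop)).continuousOn
  have := le_csSup hb ⟨p, hp, rfl⟩
  rw [letterExcess]
  linarith

lemma isLittleO_letterExcess (d : ℕ) :
    (fun n : ℕ => d * max 0 (letterExcess n) / n) =o[atTop] fun n : ℕ => 1 / (n : ℝ) := by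
  rw [Asymptotics.isLittleO_iff]
  intro c hc
  have hd : (0 : ℝ) < d + 1 := by positivity
  filter_upwards [eventually_forall_letterLoss_le (div_pos hc hd)] with n hn
  have h1 : letterExcess n ≤ c / (d + 1) := by
    refine csSup_le ⟨_, 0, by simp, rfl⟩ ?_
    rintro _ ⟨p, hp, rfl⟩
    exact hn p hp
  have h2 : max 0 (letterExcess n) ≤ c / (d + 1) := max_le (by positivity) h1
  have h3 : d * max 0 (letterExcess n) ≤ c := by
    calc d * max 0 (letterExcess n) ≤ (d + 1) * (c / (d + 1)) :=
          mul_le_mul (by linarith) h2 (le_max_left _ _) hd.le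
      _ = c := by field_simp
  have h4 : 0 ≤ max 0 (letterExcess n) := le_max_left _ _
  rw [Real.norm_of_nonneg (by positivity), Real.norm_of_nonneg (by positivity), mul_one_div]
  gcongr

/-! ### Distributions on finite alphabets -/

section

variable {d : ℕ} {p q : Fin d → ℝ}

lemma discreteLaw_apply_of_lt (p : Fin d → ℝ) (i : Fin d) :
    discreteLaw p {(i : ℕ)} = ENNReal.ofReal (p i) := by
  rw [discreteLaw, Measure.finsetSum_apply, Finset.sum_eq_single i]
  · simp
  · intro j _ hj
    have : (j : ℕ) ≠ i := fun h => hj (Fin.ext h)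
    simp [this]
  · simp

lemma discreteLaw_apply_of_ge (p : Fin d → ℝ) {k : ℕ} (hk : d ≤ k) :
    discreteLaw p {k} = 0 := by
  rw [discreteLaw, Measure.finsetSum_apply]
  refine Finset.sum_eq_zero fun j _ => ?_
  have : (j : ℕ) ≠ k := by have := j.2; omega
  simp [this]

lemma isProbabilityMeasure_discreteLaw (hp : p ∈ stdSimplex ℝ (Fin d)) :
    IsProbabilityMeasure (discreteLaw p) := by
  constructor
  rw [discreteLaw, Measure.finsetSum_apply]
  simp only [Measure.smul_apply, measure_univ, smul_eq_mul, mul_one]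
  rw [← ENNReal.ofReal_sum_of_nonneg fun i _ => hp.1 i, hp.2, ENNReal.ofReal_one]

lemma integral_discreteLaw (hp : ∀ i, 0 ≤ p i) (f : ℕ → ℝ) :
    ∫ k, f k ∂discreteLaw p = ∑ i, p i * f i := by
  rw [discreteLaw, integral_finsetSum_measure
    fun i _ => (integrable_dirac (by simp)).smul_measure (by simp)]
  refine Finset.sum_congr rfl fun i _ => ?_
  rw [integral_smul_measure, integral_dirac, ENNReal.toReal_ofReal (hp i), smul_eq_mul]

lemma integrable_discreteLaw (p : Fin d → ℝ) (f : ℕ → ℝ) : Integrable f (discreteLaw p) :=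
  integrable_finsetSum_measure.2 fun _ _ => (integrable_dirac (by simp)).smul_measure (by simp)

lemma ae_lt_discreteLaw (p : Fin d → ℝ) : ∀ᵐ k ∂discreteLaw p, k < d := by
  rw [ae_iff_of_countable]
  intro k hk
  by_contra h
  exact hk (discreteLaw_apply_of_ge p (not_lt.1 h))

/-- The density of `discreteLaw p` with respect to `discreteLaw q`. -/
noncomputable def discreteDensity (p q : Fin d → ℝ) (k : ℕ) : ℝ≥0∞ :=
  if h : k < d then ENNReal.ofReal (p ⟨k, h⟩ / q ⟨k, h⟩) else 0

lemma discreteLaw_eq_withDensity (hq : ∀ i, 0 < q i) :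
    discreteLaw p = (discreteLaw q).withDensity (discreteDensity p q) := by
  refine Measure.ext_of_singleton fun k => ?_
  rw [withDensity_apply _ (measurableSet_singleton k), lintegral_singleton]
  by_cases hk : k < d
  · have h1 := discreteLaw_apply_of_lt p ⟨k, hk⟩
    have h2 := discreteLaw_apply_of_lt q ⟨k, hk⟩
    simp only at h1 h2
    rw [h1, h2, discreteDensity, dif_pos hk, ← ENNReal.ofReal_mul' (hq _).le,
      div_mul_cancel₀ _ (hq _).ne']
  · rw [discreteLaw_apply_of_ge p (not_lt.1 hk), discreteLaw_apply_of_ge q (not_lt.1 hk), mul_zero]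

/-- Positivity of `q` gives absolute continuity; letters with `p i = 0` contribute 0 on the right.
-/
lemma klDiv_discreteLaw (hp : p ∈ stdSimplex ℝ (Fin d)) (hq : q ∈ stdSimplex ℝ (Fin d))
    (hq0 : ∀ i, 0 < q i) :
    InformationTheory.klDiv (discreteLaw p) (discreteLaw q)
      = ENNReal.ofReal (∑ i, p i * Real.log (p i / q i)) := by
  have := isProbabilityMeasure_discreteLaw hp
  have := isProbabilityMeasure_discreteLaw hq
  have hwd := discreteLaw_eq_withDensity (p := p) hq0
  have hac : discreteLaw p ≪ discreteLaw q := by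
    rw [hwd]; exact withDensity_absolutelyContinuous _ _
  have hae : llr (discreteLaw p) (discreteLaw q)
      =ᵐ[discreteLaw p] fun k => Real.log (discreteDensity p q k).toReal := by
    have h := Measure.rnDeriv_withDensity (discreteLaw q)
      (f := discreteDensity p q) Measurable.of_discrete
    rw [← hwd] at h
    filter_upwards [hac.ae_le h] with k hk
    rw [llr, hk]
  have hint : Integrable (llr (discreteLaw p) (discreteLaw q)) (discreteLaw p) :=
    integrable_discreteLaw p _
  rw [InformationTheory.klDiv_of_ac_of_integrable hac hint, integral_congr_ae hae,
    integral_discreteLaw hp.1]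
  rw [probReal_univ, probReal_univ, add_sub_cancel_right]
  congr 1
  refine Finset.sum_congr rfl fun i _ => ?_
  rw [discreteDensity, dif_pos i.2, ENNReal.toReal_ofReal (div_nonneg (hp.1 i) (hq0 i).le)]

lemma sum_mul_log_div_nonneg (hp : p ∈ stdSimplex ℝ (Fin d)) (hq : q ∈ stdSimplex ℝ (Fin d))
    (hq0 : ∀ i, 0 < q i) : 0 ≤ ∑ i, p i * Real.log (p i / q i) := by
  have h : ∑ i, (p i - q i) ≤ ∑ i, p i * Real.log (p i / q i) := by
    refine Finset.sum_le_sum fun i _ => ?_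
    rcases (hp.1 i).eq_or_lt with h | h
    · rw [← h]; simpa using (hq0 i).le
    · have h1 := Real.one_sub_inv_le_log_of_pos (div_pos h (hq0 i))
      have h2 := mul_le_mul_of_nonneg_left h1 h.le
      rw [inv_div, mul_sub, mul_one, mul_div_cancel₀ _ h.ne'] at h2
      exact h2
  rwa [Finset.sum_sub_distrib, hp.2, hq.2, sub_self] at h

/-! ### The law of the letter counts -/

lemma letterCount_le {n : ℕ} (x : Fin n → ℕ) (i : ℕ) : letterCount x i ≤ n := by
  simpa [letterCount] using Finset.card_filter_le (Finset.univ : Finset (Fin n)) fun j => x j = i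

lemma integrable_letterCount {n : ℕ} (μ : Measure (Fin n → ℕ)) [IsFiniteMeasure μ] (F : ℕ → ℝ)
    (i : ℕ) : Integrable (fun x : Fin n → ℕ => F (letterCount x i)) μ := by
  refine Integrable.of_bound (C := ∑ k ∈ Finset.range (n + 1), |F k|)
    Measurable.of_discrete.aestronglyMeasurable (ae_of_all _ fun x => ?_)
  exact Finset.single_le_sum (f := fun k => |F k|) (fun k _ => abs_nonneg _)
    (Finset.mem_range.2 (Nat.lt_succ_of_le (letterCount_le x i)))

lemma letterCount_succ {n : ℕ} (x : Fin (n + 1) → ℕ) (i : ℕ) :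
    letterCount x i = if x 0 = i then letterCount (fun j => x j.succ) i + 1
      else letterCount (fun j => x j.succ) i := by
  rw [letterCount, Fin.card_filter_univ_succ]
  rfl

/-- Conditioning on the first letter reproduces the recursion `binomialExp_succ`. -/
lemma integral_letterCount (μ : Measure ℕ) [IsProbabilityMeasure μ] (n : ℕ) (F : ℕ → ℝ) (i : ℕ) :
    ∫ x : Fin n → ℕ, F (letterCount x i) ∂(Measure.pi fun _ => μ)
      = binomialExp n (μ.real {i}) F := by
  induction n generalizing F with
  | zero => simp [binomialExp_zero, letterCount]
  | succ n ih =>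
    have hmp := measurePreserving_piFinSuccAbove (fun _ : Fin (n + 1) => μ) 0
    have h1 : ∫ x : Fin (n + 1) → ℕ, F (letterCount x i) ∂(Measure.pi fun _ => μ)
        = ∫ z : ℕ × (Fin n → ℕ), (if z.1 = i then F (letterCount z.2 i + 1)
            else F (letterCount z.2 i)) ∂(μ.prod (Measure.pi fun _ => μ)) := by
      rw [← hmp.integral_comp']
      refine integral_congr_ae (ae_of_all _ fun x => ?_)
      have := letterCount_succ x i
      simp only [this]
      split_ifs with h1 h2 h2
      · rfl
      · exact absurd h1 h2
      · exact absurd h2 h1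
      · rfl
    have hint : Integrable (fun z : ℕ × (Fin n → ℕ) => if z.1 = i then F (letterCount z.2 i + 1)
        else F (letterCount z.2 i)) (μ.prod (Measure.pi fun _ => μ)) := by
      refine Integrable.of_bound (C := ∑ k ∈ Finset.range (n + 2), |F k|)
        Measurable.of_discrete.aestronglyMeasurable (ae_of_all _ fun z => ?_)
      have := letterCount_le z.2 i
      split_ifs
      · exact Finset.single_le_sum (f := fun k => |F k|) (fun k _ => abs_nonneg _)
          (Finset.mem_range.2 (by omega))
      · exact Finset.single_le_sum (f := fun k => |F k|) (fun k _ => abs_nonneg _)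
          (Finset.mem_range.2 (by omega))
    rw [h1, integral_prod _ hint]
    have h2 : ∀ y : ℕ, (∫ x : Fin n → ℕ, (if y = i then F (letterCount x i + 1)
        else F (letterCount x i)) ∂(Measure.pi fun _ => μ))
        = (binomialExp n (μ.real {i}) fun k => F (k + 1)) * ({i} : Set ℕ).indicator 1 y
          + binomialExp n (μ.real {i}) F * (1 - ({i} : Set ℕ).indicator 1 y) := by
      intro y
      by_cases hy : y = i
      · simp only [hy, if_true]
        rw [ih fun k => F (k + 1)]
        simp
      · simp only [hy, if_false]
        rw [ih F]
        simp [hy]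
    simp only [h2]
    have hind : Integrable (fun y => ({i} : Set ℕ).indicator (1 : ℕ → ℝ) y) μ :=
      (integrable_const (1 : ℝ)).indicator (measurableSet_singleton i)
    have hind' : Integrable (fun y => 1 - ({i} : Set ℕ).indicator (1 : ℕ → ℝ) y) μ :=
      (integrable_const (1 : ℝ)).sub hind
    rw [integral_add (hind.const_mul _) (hind'.const_mul _),
      integral_const_mul, integral_const_mul, integral_sub (integrable_const _) hind,
      integral_indicator_one (measurableSet_singleton i), binomialExp_succ]
    simp
    ring

lemma discreteLaw_real_singleton (hp : ∀ i, 0 ≤ p i) (i : Fin d) :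
    (discreteLaw p).real {(i : ℕ)} = p i := by
  rw [measureReal_def, discreteLaw_apply_of_lt, ENNReal.toReal_ofReal (hp i)]

lemma sum_letterCount {n : ℕ} {x : Fin n → ℕ} (hx : ∀ j, x j < d) :
    ∑ i : Fin d, letterCount x i = n := by
  have h := Finset.card_eq_sum_card_fiberwise (s := (Finset.univ : Finset (Fin n)))
    (t := (Finset.univ : Finset (Fin d))) (f := fun j => (⟨x j, hx j⟩ : Fin d))
    (fun _ _ => Finset.mem_coe.2 (Finset.mem_univ _))
  rw [Finset.card_univ, Fintype.card_fin] at h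
  refine Eq.trans (Finset.sum_congr rfl fun i _ => ?_) h.symm
  simp [letterCount, Fin.ext_iff]

/-! ### The risk of the variable add-constant estimate -/

lemma addConst_pos {n : ℕ} (x : Fin n → ℕ) (i : ℕ) :
    0 < (letterCount x i : ℝ) + braessSauerConst (letterCount x i) :=
  add_pos_of_nonneg_of_pos (Nat.cast_nonneg _) (braessSauerConst_pos _)

lemma sum_addConst_pos (hd : 1 ≤ d) {n : ℕ} (x : Fin n → ℕ) :
    0 < ∑ k : Fin d, ((letterCount x k : ℝ) + braessSauerConst (letterCount x k)) :=
  Finset.sum_pos (fun k _ => addConst_pos x k) ⟨⟨0, hd⟩, Finset.mem_univ _⟩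

lemma variableAddConst_pos (hd : 1 ≤ d) {n : ℕ} (x : Fin n → ℕ) (i : Fin d) :
    0 < variableAddConst d x i := div_pos (addConst_pos x i) (sum_addConst_pos hd x)

lemma variableAddConst_mem_stdSimplex (hd : 1 ≤ d) {n : ℕ} (x : Fin n → ℕ) :
    variableAddConst d x ∈ stdSimplex ℝ (Fin d) := by
  refine ⟨fun i => (variableAddConst_pos hd x i).le, ?_⟩
  simp only [variableAddConst, ← Finset.sum_div]
  exact div_self (sum_addConst_pos hd x).ne'

lemma sum_mul_log_div_variableAddConst_le (hd : 1 ≤ d) {n : ℕ} (hn : 1 ≤ n)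
    (hp : p ∈ stdSimplex ℝ (Fin d)) {x : Fin n → ℕ} (hx : ∀ j, x j < d) :
    ∑ i, p i * Real.log (p i / variableAddConst d x i)
      ≤ ∑ i : Fin d, 1 / (n : ℝ) * (braessSauerConst (letterCount x i)
        - n * p i * Real.log (letterCount x i + braessSauerConst (letterCount x i))
        + n * p i * Real.log (n * p i)) := by
  have hn0 : (0 : ℝ) < n := by exact_mod_cast hn
  set S : ℝ := ∑ k : Fin d, ((letterCount x k : ℝ) + braessSauerConst (letterCount x k)) with hS
  have hS0 : 0 < S := sum_addConst_pos hd x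
  have hSn : S = n + ∑ k : Fin d, braessSauerConst (letterCount x k) := by
    rw [hS, Finset.sum_add_distrib, ← Nat.cast_sum, sum_letterCount hx]
  -- The only inequality of the lemma: linearising the logarithm of the normalisation decouples the
  -- letters.
  have hlogS : Real.log S ≤ Real.log n + (∑ k : Fin d, braessSauerConst (letterCount x k)) / n := by
    have h := Real.log_le_sub_one_of_pos (div_pos hS0 hn0)
    rw [Real.log_div hS0.ne' hn0.ne'] at h
    have : S / n - 1 = (∑ k : Fin d, braessSauerConst (letterCount x k)) / n := by
      rw [hSn]; field_simp; ring
    linarith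
  have hterm : ∀ i, p i * Real.log (p i / variableAddConst d x i)
      = p i * Real.log S + 1 / (n : ℝ) * (
        - n * p i * Real.log (letterCount x i + braessSauerConst (letterCount x i))
        + n * p i * Real.log (n * p i)) - p i * Real.log n := by
    intro i
    rcases (hp.1 i).eq_or_lt with h | h
    · rw [← h]; simp
    · have hc := addConst_pos x i
      rw [variableAddConst, ← hS, Real.log_div h.ne' (div_pos hc hS0).ne',
        Real.log_div hc.ne' hS0.ne', Real.log_mul hn0.ne' h.ne']
      field_simp
      ring
  simp only [hterm]
  rw [Finset.sum_sub_distrib, Finset.sum_add_distrib, ← Finset.sum_mul, ← Finset.sum_mul, hp.2,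
    one_mul, one_mul]
  have hsplit : ∑ i : Fin d, 1 / (n : ℝ) * (braessSauerConst (letterCount x i)
        - n * p i * Real.log (letterCount x i + braessSauerConst (letterCount x i))
        + n * p i * Real.log (n * p i))
      = (∑ k : Fin d, braessSauerConst (letterCount x k)) / n
        + ∑ i : Fin d, 1 / (n : ℝ) * (
          - n * p i * Real.log (letterCount x i + braessSauerConst (letterCount x i))
          + n * p i * Real.log (n * p i)) := by
    rw [Finset.sum_div, ← Finset.sum_add_distrib]
    refine Finset.sum_congr rfl fun i _ => ?_
    ring
  rw [hsplit]
  linarith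

lemma klRisk_variableAddConst_le (hd : 1 ≤ d) {n : ℕ} (hn : 1 ≤ n)
    (hp : p ∈ stdSimplex ℝ (Fin d)) :
    klRisk (n := n) p (fun x => discreteLaw (variableAddConst d x))
      ≤ ENNReal.ofReal (∑ i, 1 / (n : ℝ) * letterLoss n (p i)) := by
  have := isProbabilityMeasure_discreteLaw hp
  set B : (Fin n → ℕ) → ℝ := fun x => ∑ i : Fin d, 1 / (n : ℝ) *
    (braessSauerConst (letterCount x i)
      - n * p i * Real.log (letterCount x i + braessSauerConst (letterCount x i))
      + n * p i * Real.log (n * p i)) with hB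
  have hlt : ∀ᵐ x ∂(Measure.pi fun _ : Fin n => discreteLaw p), ∀ j, x j < d := by
    rw [ae_all_iff]
    exact fun j => (Measure.tendsto_eval_ae_ae (μ := fun _ : Fin n => discreteLaw p)
      (i := j)).eventually (ae_lt_discreteLaw p)
  have hkl : ∀ x : Fin n → ℕ, InformationTheory.klDiv (discreteLaw p)
      (discreteLaw (variableAddConst d x))
      = ENNReal.ofReal (∑ i, p i * Real.log (p i / variableAddConst d x i)) := fun x =>
    klDiv_discreteLaw hp (variableAddConst_mem_stdSimplex hd x) (variableAddConst_pos hd x)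
  have hterm : ∀ i : Fin d, Integrable (fun x : Fin n → ℕ => 1 / (n : ℝ) *
      (braessSauerConst (letterCount x i)
      - n * p i * Real.log (letterCount x i + braessSauerConst (letterCount x i))
      + n * p i * Real.log (n * p i))) (Measure.pi fun _ : Fin n => discreteLaw p) := fun i =>
    integrable_letterCount _ (fun k => 1 / (n : ℝ) * (braessSauerConst k
      - n * p i * Real.log (k + braessSauerConst k) + n * p i * Real.log (n * p i))) i
  have hBint : Integrable B (Measure.pi fun _ : Fin n => discreteLaw p) :=
    integrable_finsetSum _ fun i _ => hterm i
  -- `B` dominates a divergence only when every sampled letter lies in `[d]`, so that the counts sum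
  -- to `n`; this holds almost surely.
  have hB0 : 0 ≤ᵐ[Measure.pi fun _ : Fin n => discreteLaw p] B := by
    filter_upwards [hlt] with x hx
    exact (sum_mul_log_div_nonneg hp (variableAddConst_mem_stdSimplex hd x)
      (variableAddConst_pos hd x)).trans (sum_mul_log_div_variableAddConst_le hd hn hp hx)
  have hIB : ∫ x, B x ∂(Measure.pi fun _ : Fin n => discreteLaw p)
      = ∑ i, 1 / (n : ℝ) * letterLoss n (p i) := by
    rw [hB, integral_finsetSum _ fun i _ => hterm i]
    refine Finset.sum_congr rfl fun i _ => ?_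
    rw [integral_letterCount (discreteLaw p) n (fun k => 1 / (n : ℝ) * (braessSauerConst k
      - n * p i * Real.log (k + braessSauerConst k) + n * p i * Real.log (n * p i))) i,
      discreteLaw_real_singleton hp.1, binomialExp_const_mul, binomialExp_add, binomialExp_const,
      letterLoss]
  calc klRisk (n := n) p (fun x => discreteLaw (variableAddConst d x))
      ≤ ∫⁻ x, ENNReal.ofReal (B x) ∂(Measure.pi fun _ : Fin n => discreteLaw p) := by
        refine lintegral_mono_ae ?_
        filter_upwards [hlt] with x hx
        rw [hkl]
        exact ENNReal.ofReal_le_ofReal (sum_mul_log_div_variableAddConst_le hd hn hp hx)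
    _ = ENNReal.ofReal (∑ i, 1 / (n : ℝ) * letterLoss n (p i)) := by
        rw [← ofReal_integral_eq_lintegral_ofReal hBint hB0, hIB]

lemma sum_letterLoss_le (hp : p ∈ stdSimplex ℝ (Fin d)) (n : ℕ) :
    ∑ i, 1 / (n : ℝ) * letterLoss n (p i)
      ≤ ((d : ℝ) - 1) / (2 * n) + d * max 0 (letterExcess n) / n := by
  have h1 : ∀ i, letterLoss n (p i) ≤ (1 - p i) / 2 + max 0 (letterExcess n) := fun i =>
    (letterLoss_le_letterExcess (mem_Icc_of_mem_stdSimplex hp i)).trans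
      (by linarith [le_max_right 0 (letterExcess n)])
  calc ∑ i, 1 / (n : ℝ) * letterLoss n (p i)
      ≤ ∑ i, 1 / (n : ℝ) * ((1 - p i) / 2 + max 0 (letterExcess n)) :=
        Finset.sum_le_sum fun i _ => mul_le_mul_of_nonneg_left (h1 i) (by positivity)
    _ = 1 / (n : ℝ) * (((d : ℝ) - ∑ i, p i) / 2 + d * max 0 (letterExcess n)) := by
        rw [← Finset.mul_sum, Finset.sum_add_distrib, ← Finset.sum_div, Finset.sum_sub_distrib]
        simp
    _ = _ := by
        rw [hp.2, ← div_div]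
        ring

end

/-! ### The main theorem: choice of `α` -/

theorem mainTheorem4 (d : ℕ) (hd : 1 ≤ d) :
    ∃ ε : ℕ → ℝ, ε =o[atTop] (fun n : ℕ => 1 / (n : ℝ)) ∧
      ∀ n : ℕ, 1 ≤ n → ∀ Δ : ℝ, 0 ≤ Δ →
        ∃ α : ℝ, α ∈ Set.Icc (0 : ℝ) 1 ∧
          ∀ (d₀ : ℕ) (p₀ : Fin d₀ → ℝ), p₀ ∈ stdSimplex ℝ (Fin d₀) →
            worstCaseRisk d n p₀ Δ α ≠ ∞ ∧
            (worstCaseRisk d n p₀ Δ α).toReal ≤ min (((d : ℝ) - 1) / (2 * n) + ε n) Δ := by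
  refine ⟨fun n => d * max 0 (letterExcess n) / n, isLittleO_letterExcess d, fun n hn Δ hΔ => ?_⟩
  set R : ℝ := ((d : ℝ) - 1) / (2 * n) + d * max 0 (letterExcess n) / n with hR
  have hd' : (1 : ℝ) ≤ d := by exact_mod_cast hd
  have hR0 : 0 ≤ R := by
    have : 0 ≤ max 0 (letterExcess n) := le_max_left _ _
    have : 0 ≤ (d : ℝ) - 1 := by linarith
    positivity
  suffices h : ∃ α : ℝ, α ∈ Set.Icc (0 : ℝ) 1 ∧ ∀ (d₀ : ℕ) (p₀ : Fin d₀ → ℝ),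
      p₀ ∈ stdSimplex ℝ (Fin d₀) → worstCaseRisk d n p₀ Δ α ≤ ENNReal.ofReal (min R Δ) by
    obtain ⟨α, hα, h⟩ := h
    refine ⟨α, hα, fun d₀ p₀ hp₀ => ⟨ne_top_of_le_ne_top ENNReal.ofReal_ne_top (h d₀ p₀ hp₀), ?_⟩⟩
    exact ENNReal.toReal_le_of_le_ofReal (le_min hR0 hΔ) (h d₀ p₀ hp₀)
  -- The choice compares `Δ` with `R`, neither of which involves `π⁽⁰⁾`; hence `α` depends only on
  -- `d`, `n` and `Δ`.
  rcases le_total Δ R with h | h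
  · refine ⟨0, ⟨le_rfl, zero_le_one⟩, fun d₀ p₀ _ => iSup₂_le fun p hp => ?_⟩
    have := isProbabilityMeasure_discreteLaw hp.1
    have hest : (interpolationEstimator d p₀ 0 : (Fin n → ℕ) → Measure ℕ)
        = fun _ => discreteLaw p₀ := by
      funext x
      simp [interpolationEstimator]
    rw [hest, klRisk, lintegral_const, measure_univ, mul_one, min_eq_right h]
    exact hp.2
  · refine ⟨1, ⟨zero_le_one, le_rfl⟩, fun d₀ p₀ _ => iSup₂_le fun p hp => ?_⟩
    have hest : (interpolationEstimator d p₀ 1 : (Fin n → ℕ) → Measure ℕ)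
        = fun x => discreteLaw (variableAddConst d x) := by
      funext x
      simp [interpolationEstimator]
    rw [hest, min_eq_left h]
    exact (klRisk_variableAddConst_le hd hn hp.1).trans
      (ENNReal.ofReal_le_ofReal (sum_letterLoss_le hp.1 n))
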